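/- Let $d\ge 2$ and let $s_1,\dots,s_d\ge 2$ be integers. Put $m=s_1s_2\cdots s_{d-1}$ and suppose that $s_d\ge ((d-1)m)!+1$. Let $K=K^{(d)}_{s_1,\dots,s_d}$ be the complete $d$-partite $d$-uniform hypergraph with parts of sizes $s_1,\dots,s_d$, and let $\operatorname{ex}_d(n,K)$ be the maximum number of edges of a $d$-uniform hypergraph on $n$ vertices that contains no copy of $K$ (as a not necessarily induced subhypergraph). Then, as $n\to\infty$, $$\operatorname{ex}_d(n,K)=\Theta\left(n^{\,d-\frac{1}{s_1\cdots s_{d-1}}}\right),$$ where the implied constants depend only on $d,s_1,\dots,s_d$. Moreover, the lower bound is attained by the following norm hypergraphs: there is a constant $c>0$, depending only on $d,s_1,\dots,s_d$, such that the following holds for every prime $p$. Let $q=p^m$ and $q'=q^{d-1}$, consider $\mathbb F_p\subset\mathbb F_q\subset\mathbb F_{q'}$, and let $N:\mathbb F_{q'}\to\mathbb F_p$ be the norm map. There exist $\alpha_1,\dots,\alpha_d\in\mathbb F_{q'}$ any $d-1$ of which are linearly independent over $\mathbb F_q$. For any such $\alpha_1,\dots,\alpha_d$, put $L_i(x)=\sum_{j\ne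 i}\frac{\alpha_j}{\alpha_i}x_j$ for $x\in\mathbb F_q^d$ and $1\le i\le d$, and call $\mathcal F\subset\mathbb F_q^d$ separated if $L_i(x)\neq g(L_i(y))$ for all $i$, all $x,y\in\mathcal F$ and all $g\in\operatorname{Gal}(\mathbb F_{q'}/\mathbb F_q)$ with $g\ne 1$. For $\mathcal F\subset \mathbb F_q^d$ and $t\in\mathbb F_p^*$ let $$\mathcal H_t=\{x\in\mathcal F:\ N(\alpha_1x_1+\dots+\alpha_dx_d)=t\},$$ regarded as a $d$-partite $d$-uniform hypergraph whose parts are $d$ disjoint copies of $\mathbb F_q$. Then (i) there are a separated $\mathcal F$ with $|\mathcal F|\ge c\,q^d$ and a $t\in\mathbb F_p^*$ such that $\mathcal H_t$ has at least $c\,q^d/p$ edges (note that $q^d/p=q^{d-1/m}$); (ii) for every separated $\mathcal F$ and every $t\in\mathbb F_p^*$, the hypergraph $\mathcal H_t$ contains no copy of $K$. -/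

import Mathlib

open scoped Nat

/-!
A finite `d`-uniform hypergraph on a vertex type `V` is given by its set of edges
`H : Finset (Finset V)`, every edge having exactly `d` elements
(`(H : Set (Finset V)).Sized d`).
-/

namespace NormHypergraph

/-- `H` contains a (not necessarily induced) copy of `K`: some injection of the vertices of `K`
into the vertices of `H` maps every edge of `K` to an edge of `H`. -/
def ContainsCopy {W V : Type*} (K : Finset (Finset W)) (H : Finset (Finset V)) : Prop :=
  ∃ f : W ↪ V, ∀ e ∈ K, e.map f ∈ H

/-- The transversal edge `{(1, x₁), …, (d, x_d)}` of the disjoint union of `d` parts. -/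
def transversal {d : ℕ} {P : Fin d → Type*} (x : ∀ i, P i) : Finset (Σ i, P i) :=
  Finset.univ.map ⟨fun i => ⟨i, x i⟩, fun _ _ h => congrArg Sigma.fst h⟩

open Classical in
/-- The complete `d`-partite `d`-uniform hypergraph with parts of sizes `s₁, …, s_d`. -/
noncomputable def completePartite {d : ℕ} (s : Fin d → ℕ) :
    Finset (Finset (Σ i, Fin (s i))) :=
  Finset.univ.image fun x : (∀ i, Fin (s i)) => transversal x

open Classical in
/-- The Turán number `ex_d(n, K)`: the maximum number of edges in a `d`-uniform hypergraph on
`n` vertices which contains no copy of `K`. -/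
noncomputable def turanNumber (d n : ℕ) {W : Type*} (K : Finset (Finset W)) : ℕ :=
  (Finset.univ.filter fun H : Finset (Finset (Fin n)) =>
    (H : Set (Finset (Fin n))).Sized d ∧ ¬ ContainsCopy K H).sup Finset.card

/-- Any `d - 1` of the elements `α₁, …, α_d` of `L` are linearly independent over `E`. -/
def GeneralPosition (E : Type*) {L : Type*} [Field E] [Field L] [Algebra E L] {d : ℕ}
    (α : Fin d → L) : Prop :=
  ∀ i, LinearIndependent E fun j : {j : Fin d // j ≠ i} => α j.1

/-- The linear form `L_i(x) = ∑_{j ≠ i} (α_j / α_i) x_j`. -/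
noncomputable def linForm {E L : Type*} [Field E] [Field L] [Algebra E L] {d : ℕ}
    (α : Fin d → L) (i : Fin d) (x : Fin d → E) : L :=
  ∑ j ∈ Finset.univ.erase i, α j / α i * algebraMap E L (x j)

/-- The set `F ⊆ E ^ d` is such that `L_i(x) ≠ g (L_i(y))` for all `i`, all `x, y ∈ F` and all
nontrivial elements `g` of the Galois group of `L / E`. -/
def GaloisSeparated {E L : Type*} [Field E] [Field L] [Algebra E L] {d : ℕ}
    (α : Fin d → L) (F : Finset (Fin d → E)) : Prop :=
  ∀ i, ∀ g : L ≃ₐ[E] L, g ≠ 1 → ∀ x ∈ F, ∀ y ∈ F, linForm α i x ≠ g (linForm α i y)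

open Classical in
/-- The norm hypergraph `H_t`. It is `d`-partite with parts `E, …, E` (so it has `d * |E|`
vertices), and its edges are the tuples `x ∈ F` with `N(α₁ x₁ + … + α_d x_d) = t`, where `N` is
the norm from `L` to the prime field. -/
noncomputable def normHypergraph (p : ℕ) {E L : Type*} [Field E] [Field L] [Algebra E L]
    [Algebra (ZMod p) L] {d : ℕ} (α : Fin d → L) (F : Finset (Fin d → E)) (t : ZMod p) :
    Finset (Finset (Σ _ : Fin d, E)) :=
  (F.filter fun x =>
    Algebra.norm (ZMod p) (∑ j, α j * algebraMap E L (x j)) = t).image fun x => transversal x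

end NormHypergraph

/-! Write `k = d - 1`. For the upper bound, convexity shows that blowing up `k` of the vertex
classes raises the edge density at most to the power `m` (`density_pow_prod_le_density_blowup`).
Without a copy of `K`, the blown-up density is `O(1/n)`: an injective choice of the first `k`
classes has fewer than `s_d` common neighbours, and non-injective choices are rare.

For the lower bound, `N(∑ α_j x_j) = t` reads `N(x_i + L_i(x)) = t / N(α_i)`. If the last class of a
copy of `K` lands in part `i`, the other classes supply `m` values `ℓ` of `L_i`. Every vertex `y` of
that last class solves all `m` equations `N(y + ℓ) = t / N(α_i)`. The norm is a product over
Frobenius powers and Galois conjugates, so with `x_j = y ^ p ^ j` these become `m` equations in `m`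
unknowns, each side a product of factors `x_j - a_{ijl}`. Separation and general position make the
constants of different equations differ.

Such a system takes at most `m! k^m` values in each coordinate (`card_image_le_of_forall_prod_eq`).
A valuation argument makes each `X_j` integral over the subring generated by the left-hand sides
`f_i`. That subring is a polynomial ring, hence integrally closed, and a dimension count bounds the
degree of the minimal polynomial, which stays monic when `f_i` is set to `b_i`.

Dense separated sets come from discarding few bad tuples and taking a largest colour class;
Bertrand's postulate handles general `n`. -/

namespace NormHypergraph

/-! ### Split systems: integrality and algebraic independence -/

/-- An element of a field lying in every valuation ring that contains the range of `θ` is integral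
over `θ`. -/
lemma isIntegralElem_of_forall_valuationSubring {B Q : Type*} [CommRing B] [Field Q]
    (θ : B →+* Q) (x : Q) (h : ∀ V : ValuationSubring Q, (∀ b, θ b ∈ V) → x ∈ V) :
    θ.IsIntegralElem x := by
  have h1 : x ∈ (⨅ V : {V : ValuationSubring Q // (θ.range : Set Q) ⊆ V.toSubring},
      V.1.toSubring) := by
    rw [Subring.mem_iInf]
    rintro ⟨V, hV⟩
    exact h V fun b => hV ⟨b, rfl⟩
  rw [iInf_valuationSubring_superset] at h1
  obtain ⟨p, hp, hpx⟩ : IsIntegral (Subring.closure (θ.range : Set Q)) x := h1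
  have hle : ∀ y : Subring.closure (θ.range : Set Q), (y : Q) ∈ θ.range := by
    intro y
    exact Subring.closure_le.2 le_rfl y.2
  have hp2 : (p.map (algebraMap (Subring.closure (θ.range : Set Q)) Q)) ∈
      Polynomial.lifts θ := by
    rw [Polynomial.lifts_iff_coeff_lifts]
    intro n
    rw [Polynomial.coeff_map]
    exact hle _
  obtain ⟨r, hr, -, hr2⟩ := Polynomial.lifts_and_natDegree_eq_and_monic hp2 (hp.map _)
  refine ⟨r, hr2, ?_⟩
  rw [← Polynomial.eval_map, hr, Polynomial.eval_map]
  exact hpx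

section System

variable {K ι J : Type*} [Field K] [Fintype ι] [Fintype J]

open MvPolynomial

/-- The polynomials `∏_j ∏_l (X_j - a_{ijl})`. -/
noncomputable def splitPoly (a : ι → ι → J → K) (i : ι) : MvPolynomial ι K :=
  ∏ j, ∏ l, (X j - C (a i j l))

variable {a : ι → ι → J → K}

/-- If `X_j` had a pole, each `f_i` would need a compensating factor of valuation below 1 in a
variable other than `X_j`. Two equations cannot use the same variable, since their constants differ
by a unit. This injects `ι` into `ι` without `j`. -/
lemma valuationSubring_mem_of_splitPoly_mem [Nonempty J]
    (ha : ∀ i i' j l l', i ≠ i' → a i j l ≠ a i' j l')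
    {Q : Type*} [Field Q] (ψ : MvPolynomial ι K →+* Q) (V : ValuationSubring Q)
    (hC : ∀ c, ψ (C c) ∈ V) (hf : ∀ i, ψ (splitPoly a i) ∈ V) (j : ι) : ψ (X j) ∈ V := by
  classical
  by_contra hj
  set v := V.valuation with hv
  have hC1 : ∀ c, v (ψ (C c)) ≤ 1 := fun c => (V.valuation_le_one_iff _).2 (hC c)
  have hC2 : ∀ c, c ≠ 0 → v (ψ (C c)) = 1 := by
    intro c hc
    refine le_antisymm (hC1 c) ?_
    by_contra hlt
    have h1 : v (ψ (C c)) * v (ψ (C c⁻¹)) = 1 := by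
      rw [← map_mul, ← map_mul, ← C_mul, mul_inv_cancel₀ hc, C_1, map_one, map_one]
    have h2 : v (ψ (C c)) * v (ψ (C c⁻¹)) < 1 :=
      mul_lt_one_of_lt_of_le (not_le.1 hlt) (hC1 _)
    exact h2.ne h1
  have hbig : ∀ j', ψ (X j') ∉ V → ∀ c, 1 < v (ψ (X j' - C c)) := by
    intro j' hj' c
    have h1 : 1 < v (ψ (X j')) := by
      rw [← not_le]
      exact fun h => hj' ((V.valuation_le_one_iff _).1 h)
    rw [map_sub, Valuation.map_sub_eq_of_lt_left]
    · exact h1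
    · exact (hC1 c).trans_lt h1
  have key : ∀ i, ∃ j', j' ≠ j ∧ ∃ l, v (ψ (X j' - C (a i j' l))) < 1 := by
    intro i
    by_contra! hcon
    have h1 : v (ψ (splitPoly a i)) ≤ 1 := (V.valuation_le_one_iff _).2 (hf i)
    rw [splitPoly, map_prod, map_prod, ← Finset.mul_prod_erase _ _ (Finset.mem_univ j)] at h1
    have h2 : 1 ≤ ∏ j' ∈ Finset.univ.erase j, v (ψ (∏ l, (X j' - C (a i j' l)))) := by
      refine Finset.one_le_prod' fun j' hj' => ?_
      rw [map_prod, map_prod]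
      exact Finset.one_le_prod' fun l _ => hcon j' (Finset.ne_of_mem_erase hj') l
    -- `J` must be nonempty here, so that `X j` really occurs in every equation.
    have h3 : 1 < v (ψ (∏ l, (X j - C (a i j l)))) := by
      obtain ⟨l₀⟩ := ‹Nonempty J›
      rw [map_prod, map_prod, ← Finset.mul_prod_erase _ _ (Finset.mem_univ l₀)]
      exact (hbig j hj _).trans_le (le_mul_of_one_le_right' (Finset.one_le_prod' fun l _ =>
        (hbig j hj _).le))
    exact absurd (h3.trans_le (le_mul_of_one_le_right' h2)) (not_lt.2 h1)
  choose g hg l hl using key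
  have hinj : Function.Injective g := by
    intro i i' hii
    by_contra hne
    have h1 := hl i
    have h2 := hl i'
    rw [← hii] at h2
    have h3 : v (ψ (C (a i (g i) (l i) - a i' (g i) (l i')))) < 1 := by
      have : ψ (C (a i (g i) (l i) - a i' (g i) (l i'))) =
          ψ (X (g i) - C (a i' (g i) (l i'))) - ψ (X (g i) - C (a i (g i) (l i))) := by
        rw [← map_sub]; congr 1; rw [C_sub]; ring
      rw [this]
      exact Valuation.map_sub_lt v h2 h1
    exact h3.ne (hC2 _ (sub_ne_zero.2 (ha _ _ _ _ _ hne)))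
  obtain ⟨i, hi⟩ := (Finite.injective_iff_surjective.1 hinj) j
  exact hg i hi

lemma splitPoly_isIntegralElem [Nonempty J]
    (ha : ∀ i i' j l l', i ≠ i' → a i j l ≠ a i' j l') (j : ι) :
    (aeval (splitPoly a) : MvPolynomial ι K →ₐ[K] MvPolynomial ι K).toRingHom.IsIntegralElem
      (X j) := by
  set θ := (aeval (splitPoly a) : MvPolynomial ι K →ₐ[K] MvPolynomial ι K) with hθ
  let ψ := algebraMap (MvPolynomial ι K) (FractionRing (MvPolynomial ι K))
  have h : (ψ.comp θ.toRingHom).IsIntegralElem (ψ (X j)) := by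
    refine isIntegralElem_of_forall_valuationSubring _ _ fun V hV => ?_
    refine valuationSubring_mem_of_splitPoly_mem ha ψ V (fun c => ?_) (fun i => ?_) j
    · have := hV (C c)
      simpa [hθ] using this
    · have := hV (X i)
      simpa [hθ] using this
  obtain ⟨p, hp, hpx⟩ := h
  refine ⟨p, hp, ?_⟩
  rw [← Polynomial.hom_eval₂] at hpx
  exact (map_eq_zero_iff ψ (IsFractionRing.injective _ _)).1 hpx

/-- The polynomial ring is integral over the algebra generated by these `m` elements and has
transcendence degree `m`, so they form a transcendence basis. -/
lemma algebraicIndependent_splitPoly [Nonempty J]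
    (ha : ∀ i i' j l l', i ≠ i' → a i j l ≠ a i' j l') :
    AlgebraicIndependent K (splitPoly a) := by
  have halg : Algebra.IsAlgebraic (Algebra.adjoin K (Set.range (splitPoly a)))
      (MvPolynomial ι K) := by
    have : Algebra.IsIntegral (Algebra.adjoin K (Set.range (splitPoly a)))
        (MvPolynomial ι K) := by
      have hX : ∀ j, IsIntegral (Algebra.adjoin K (Set.range (splitPoly a)))
          (X j : MvPolynomial ι K) := by
        intro j
        obtain ⟨p, hp, hpx⟩ := splitPoly_isIntegralElem ha j
        have hmem : ∀ b : MvPolynomial ι K, aeval (splitPoly a) b ∈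
            Algebra.adjoin K (Set.range (splitPoly a)) := by
          intro b
          rw [Algebra.adjoin_range_eq_range_aeval]
          exact ⟨b, rfl⟩
        refine ⟨p.map ((aeval (splitPoly a)).codRestrict _ hmem).toRingHom, hp.map _, ?_⟩
        rw [Polynomial.eval₂_map]
        exact hpx
      refine ⟨fun q => ?_⟩
      induction q using MvPolynomial.induction_on with
      | C c => exact isIntegral_algebraMap (R := Algebra.adjoin K (Set.range (splitPoly a)))
                 (x := algebraMap K _ c)
      | add p q hp hq => exact hp.add hq
      | mul_X p j hp => exact hp.mul (hX j)
    infer_instance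
  refine (Algebra.IsAlgebraic.isTranscendenceBasis_of_lift_le_trdeg_of_finite (R := K)
    (splitPoly a) ?_).1
  rw [MvPolynomial.trdeg_of_isDomain]
  simp

end System
-- Split systems: degree of the integral equation
/-- Over an integrally closed domain, an integral element annihilated by a nonzero polynomial is
annihilated by a monic polynomial of no larger degree. -/
lemma exists_monic_natDegree_le_of_isIntegralElem {B R : Type*} [CommRing B] [CommRing R]
    [IsDomain B] [IsDomain R] [IsIntegrallyClosed B] (θ : B →+* R) (hθ : Function.Injective θ)
    {x : R} (hx : θ.IsIntegralElem x) {P : Polynomial B} (hP : P ≠ 0)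
    (hPx : P.eval₂ θ x = 0) :
    ∃ Q : Polynomial B, Q.Monic ∧ Q.natDegree ≤ P.natDegree ∧ Q.eval₂ θ x = 0 := by
  let := θ.toAlgebra
  have : FaithfulSMul B R := (faithfulSMul_iff_algebraMap_injective B R).2 hθ
  have hx' : IsIntegral B x := hx
  exact ⟨minpoly B x, minpoly.monic hx', Polynomial.natDegree_le_natDegree
    (minpoly.IsIntegrallyClosed.degree_le_of_ne_zero hP hPx), minpoly.aeval B x⟩

/-- Compare leading coefficients in `T`: `k^m` on the left, `k^m + 1/m!` on the right. This is the
numerical input of the dimension count below. -/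
lemma exists_pow_lt_mul_choose (k m : ℕ) :
    ∃ T : ℕ, (k * T + m ! * k ^ m + 1) ^ m < (m ! * k ^ m + 1) * (T + m).choose m := by
  set N := m ! * k ^ m with hN
  have h1 : Filter.Tendsto (fun T : ℕ => (((k * T + N + 1 : ℕ) : ℝ) / ((T + 1 : ℕ) : ℝ)) ^ m)
      Filter.atTop (nhds ((k : ℝ) ^ m)) := by
    apply Filter.Tendsto.pow
    have : (fun T : ℕ => (((k * T + N + 1 : ℕ) : ℝ) / ((T + 1 : ℕ) : ℝ))) =
        fun T : ℕ => (k : ℝ) + ((N : ℝ) + 1 - k) * (1 / ((T : ℝ) + 1)) := by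
      funext T
      have : ((T : ℝ) + 1) ≠ 0 := by positivity
      push_cast; field_simp; ring
    rw [this]
    simpa using (tendsto_one_div_add_atTop_nhds_zero_nat.const_mul
      ((N : ℝ) + 1 - k)).const_add (k : ℝ)
  have hpos : (0 : ℝ) < 1 / (m ! : ℝ) := by positivity
  obtain ⟨T, hT⟩ := (h1.eventually (gt_mem_nhds (lt_add_of_pos_right _ hpos))).exists
  refine ⟨T, ?_⟩
  have h2 : (T + 1) ^ m ≤ m ! * (T + m).choose m := by
    rw [← Nat.ascFactorial_eq_factorial_mul_choose]
    exact Nat.pow_succ_le_ascFactorial _ _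
  have h3 : m ! * (k * T + N + 1) ^ m < (N + 1) * (T + 1) ^ m := by
    have hT0 : (0 : ℝ) < ((T + 1 : ℕ) : ℝ) ^ m := by positivity
    rw [div_pow, div_lt_iff₀ hT0] at hT
    have hm0 : (0 : ℝ) < (m ! : ℝ) := by positivity
    have h4 := mul_lt_mul_of_pos_left hT hm0
    rw [← mul_assoc, mul_add, mul_one_div_cancel hm0.ne'] at h4
    rw [hN] at h4 ⊢
    exact_mod_cast h4
  have h5 : m ! * (k * T + N + 1) ^ m < m ! * ((N + 1) * (T + m).choose m) :=
    h3.trans_le ((Nat.mul_le_mul_left _ h2).trans_eq (by ring))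
  exact lt_of_mul_lt_mul_left' h5

section System

variable {K ι J : Type*} [Field K] [Fintype ι] [Fintype J]

open MvPolynomial

lemma degreeOf_splitPoly_le (a : ι → ι → J → K) (i j : ι) :
    (splitPoly a i).degreeOf j ≤ Fintype.card J := by
  classical
  refine (degreeOf_prod_le _ _ _).trans ?_
  calc ∑ j', (∏ l, (X j' - C (a i j' l)) : MvPolynomial ι K).degreeOf j
      ≤ ∑ j', if j = j' then Fintype.card J else 0 := by
        refine Finset.sum_le_sum fun j' _ => (degreeOf_prod_le _ _ _).trans ?_
        calc ∑ l, (X j' - C (a i j' l) : MvPolynomial ι K).degreeOf j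
            ≤ ∑ _l : J, if j = j' then 1 else 0 := by
              refine Finset.sum_le_sum fun l _ => (degreeOf_sub_le _ _ _).trans ?_
              rw [degreeOf_X, degreeOf_C]
              simp
          _ = _ := by split_ifs <;> simp
    _ = _ := by simp

/-- Dimension count: with `N = m! k^m`, the products `f^e X_j^c` with `|e| ≤ T` and `c ≤ N` have
degree at most `kT + N` in each variable. For suitable `T` they outnumber the monomials available,
and a linear relation among them is the required polynomial. -/
lemma exists_ne_zero_eval₂_splitPoly_eq_zero (a : ι → ι → J → K) (j : ι) :
    ∃ P : Polynomial (MvPolynomial ι K), P ≠ 0 ∧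
      P.natDegree ≤ (Fintype.card ι)! * Fintype.card J ^ Fintype.card ι ∧
      P.eval₂ (aeval (splitPoly a) : MvPolynomial ι K →ₐ[K] MvPolynomial ι K).toRingHom
        (X j) = 0 := by
  classical
  set m := Fintype.card ι with hm
  set k := Fintype.card J with hk
  set N := m ! * k ^ m with hN
  obtain ⟨T, hT⟩ := exists_pow_lt_mul_choose k m
  rw [← hN] at hT
  -- The index `none` is a slack variable, turning total degree at most `T` into exactly `T`.
  let S := (Finset.univ : Finset (Option ι)).finsuppAntidiag T
  have hScard : Fintype.card S = (T + m).choose m := by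
    rw [Fintype.card_coe, Finset.card_finsuppAntidiag_nat_eq_choose, Finset.card_univ,
      Fintype.card_option, Nat.add_right_comm, Nat.add_sub_cancel, add_comm T m,
      Nat.choose_symm_add]
  have hSsum : ∀ e : S, ∑ i, (e : Option ι →₀ ℕ).some i ≤ T := by
    intro e
    have h1 := (Finset.mem_finsuppAntidiag.1 e.2).1
    rw [Fintype.sum_option] at h1
    simp only [Finsupp.some_apply]
    lia
  have hSinj : ∀ e e' : S, (e : Option ι →₀ ℕ).some = (e' : Option ι →₀ ℕ).some → e = e' := by
    intro e e' h
    have h1 := (Finset.mem_finsuppAntidiag.1 e.2).1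
    have h2 := (Finset.mem_finsuppAntidiag.1 e'.2).1
    rw [Fintype.sum_option] at h1 h2
    have h3 : ∀ i, (e : Option ι →₀ ℕ) (some i) = (e' : Option ι →₀ ℕ) (some i) := fun i => by
      rw [← Finsupp.some_apply, ← Finsupp.some_apply, h]
    have h4 : (e : Option ι →₀ ℕ) none = (e' : Option ι →₀ ℕ) none := by
      rw [Finset.sum_congr rfl fun i _ => h3 i] at h1
      lia
    apply Subtype.ext
    ext o
    cases o with
    | none => exact h4
    | some i => exact h3 i
  let w : Fin (N + 1) × S → MvPolynomial ι K := fun c =>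
    aeval (splitPoly a) (monomial (c.2 : Option ι →₀ ℕ).some (1 : K)) * X j ^ (c.1 : ℕ)
  have hw : ∀ c i, (w c).degreeOf i ≤ k * T + N := by
    intro c i
    refine (degreeOf_mul_le _ _ _).trans (add_le_add ?_ ?_)
    · rw [aeval_monomial, map_one, one_mul, Finsupp.prod_fintype _ _ (fun _ => pow_zero _)]
      refine (degreeOf_prod_le _ _ _).trans ?_
      calc _ ≤ ∑ i', (c.2 : Option ι →₀ ℕ).some i' * k :=
            Finset.sum_le_sum fun i' _ => (degreeOf_pow_le _ _ _).trans
              (Nat.mul_le_mul_left _ (degreeOf_splitPoly_le a _ _))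
        _ = (∑ i', (c.2 : Option ι →₀ ℕ).some i') * k := by rw [Finset.sum_mul]
        _ ≤ T * k := Nat.mul_le_mul_right _ (hSsum _)
        _ = k * T := mul_comm _ _
    · refine (degreeOf_pow_le _ _ _).trans ?_
      rw [degreeOf_X]
      have := c.1.2
      split_ifs <;> lia
  let Φ : ((Fin (N + 1) × S) → K) →ₗ[K] MvPolynomial ι K := Fintype.linearCombination K w
  let Ψ : MvPolynomial ι K →ₗ[K] ((ι → Fin (k * T + N + 1)) → K) :=
    LinearMap.pi fun e => lcoeff K (Finsupp.equivFunOnFinite.symm fun i => (e i : ℕ))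
  have hker : LinearMap.ker (Ψ ∘ₗ Φ) ≠ ⊥ := by
    apply LinearMap.ker_ne_bot_of_finrank_lt
    simp only [Module.finrank_fintype_fun_eq_card, Fintype.card_prod, Fintype.card_fin,
      Fintype.card_pi, Finset.prod_const, Finset.card_univ, hScard]
    exact hT
  obtain ⟨g, hg, hg0⟩ := (Submodule.ne_bot_iff _).1 hker
  -- `Ψ` only reads the coefficients in a box; the degree bound puts all of `Φ g` in that box.
  have hΦ : Φ g = 0 := by
    have hdeg : ∀ i, (Φ g).degreeOf i ≤ k * T + N := by
      intro i
      rw [Fintype.linearCombination_apply]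
      refine (degreeOf_sum_le _ _ _).trans (Finset.sup_le fun c _ => ?_)
      rw [smul_eq_C_mul]
      exact (degreeOf_C_mul_le _ _ _).trans (hw c i)
    ext e
    rw [coeff_zero]
    by_contra hne
    have hlt : ∀ i, e i < k * T + N + 1 := fun i =>
      Nat.lt_succ_of_le (degreeOf_le_iff.1 (hdeg i) e (mem_support_iff.2 hne))
    have h1 := congrFun (LinearMap.mem_ker.1 hg) fun i => ⟨e i, hlt i⟩
    change coeff (Finsupp.equivFunOnFinite.symm fun i => e i) (Φ g) = 0 at h1
    exact hne (by rwa [show (Finsupp.equivFunOnFinite.symm fun i => e i) = e from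
      Finsupp.ext fun _ => rfl] at h1)
  refine ⟨∑ c : Fin (N + 1) × S, Polynomial.monomial (c.1 : ℕ)
    (monomial (c.2 : Option ι →₀ ℕ).some (g c)), ?_, ?_, ?_⟩
  · intro h0
    apply hg0
    funext c
    have h1 := congrArg (fun P => coeff (c.2 : Option ι →₀ ℕ).some
      (Polynomial.coeff P (c.1 : ℕ))) h0
    simp only [Polynomial.finsetSum_coeff, Polynomial.coeff_zero, coeff_zero, coeff_sum] at h1
    rw [Finset.sum_eq_single c] at h1
    · simpa using h1
    · intro c' _ hc'
      rw [Polynomial.coeff_monomial]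
      split_ifs with h2
      · rw [coeff_monomial, if_neg]
        intro h3
        exact hc' (Prod.ext (Fin.ext h2) (hSinj _ _ h3))
      · simp
    · simp
  · refine Polynomial.natDegree_sum_le_of_forall_le _ _ fun c _ => ?_
    exact (Polynomial.natDegree_monomial_le _).trans (Nat.lt_succ_iff.1 c.1.2)
  · rw [Polynomial.eval₂_finsetSum]
    rw [Fintype.linearCombination_apply] at hΦ
    rw [← hΦ]
    refine Finset.sum_congr rfl fun c _ => ?_
    rw [Polynomial.eval₂_monomial]
    have : monomial (c.2 : Option ι →₀ ℕ).some (g c) =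
        g c • monomial (c.2 : Option ι →₀ ℕ).some (1 : K) := by
      rw [smul_monomial, smul_eq_mul, mul_one]
    rw [this]
    change aeval (splitPoly a) _ * _ = _
    rw [map_smul, smul_mul_assoc]

/-- The number of values of a coordinate on the solution set of the system
`∏_j ∏_l (x_j - a_{ijl}) = b_i` is at most `m! k ^ m`. -/
theorem card_image_le_of_forall_prod_eq [DecidableEq K] [Nonempty J] {a : ι → ι → J → K}
    (ha : ∀ i i' j l l', i ≠ i' → a i j l ≠ a i' j l') (b : ι → K) (j : ι)
    (S : Finset (ι → K)) (hS : ∀ x ∈ S, ∀ i, ∏ j, ∏ l, (x j - a i j l) = b i) :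
    (S.image fun x => x j).card ≤ (Fintype.card ι)! * Fintype.card J ^ Fintype.card ι := by
  obtain ⟨P, hP0, hPd, hPx⟩ := exists_ne_zero_eval₂_splitPoly_eq_zero a j
  obtain ⟨Q, hQm, hQd, hQx⟩ := exists_monic_natDegree_le_of_isIntegralElem _
    (algebraicIndependent_splitPoly ha) (splitPoly_isIntegralElem ha j) hP0 hPx
  -- Monicity keeps the equation nonzero under the specialization of each `f_i` to `b i`.
  set q := Q.map (eval b) with hq
  have hqm : q.Monic := hQm.map _
  have hroot : ∀ x ∈ S, q.eval (x j) = 0 := by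
    intro x hx
    have h1 := congrArg (eval x) hQx
    rw [Polynomial.hom_eval₂, map_zero, eval_X] at h1
    rw [hq, Polynomial.eval_map, ← h1]
    congr 1
    apply MvPolynomial.ringHom_ext
    · intro c
      simp
    · intro i
      simp [splitPoly, hS x hx i]
  calc (S.image fun x => x j).card ≤ q.roots.toFinset.card := by
        refine Finset.card_le_card fun y hy => ?_
        obtain ⟨x, hx, rfl⟩ := Finset.mem_image.1 hy
        rw [Multiset.mem_toFinset, Polynomial.mem_roots hqm.ne_zero]
        exact hroot x hx
    _ ≤ q.natDegree := (Multiset.toFinset_card_le _).trans (Polynomial.card_roots' _)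
    _ ≤ _ := Polynomial.natDegree_map_le.trans (hQd.trans hPd)

end System

/-- Links the bound `m! k^m` obtained for the system to the factorial in the hypothesis on `s_d`. -/
lemma factorial_mul_pow_le_factorial {k : ℕ} (hk : 1 ≤ k) (m : ℕ) :
    m ! * k ^ m ≤ (k * m)! := by
  induction m with
  | zero => simp
  | succ m ih =>
    calc (m + 1)! * k ^ (m + 1) = (k * m + k) * (m ! * k ^ m) := by
          rw [Nat.factorial_succ, pow_succ]; ring
      _ ≤ (k * m + k) * (k * m + k - 1)! := by
          refine Nat.mul_le_mul_left _ (ih.trans (Nat.factorial_le ?_))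
          lia
      _ = (k * (m + 1))! := by
          rw [Nat.mul_factorial_pred (by lia), mul_add, mul_one]

/-! ### Common solutions of norm equations -/

section Norm

variable (p : ℕ) [Fact p.Prime] {E L : Type*} [Field E] [Field L] [Finite L]
  [Algebra (ZMod p) E] [Algebra (ZMod p) L] [Algebra E L] [IsScalarTower (ZMod p) E L]

/-- Transitivity of the norm: conjugates give the norm from `L` to `E`, Frobenius powers the norm
from `E` to the prime field. -/
lemma algebraMap_norm_eq_prod_prod (z : L) :
    algebraMap (ZMod p) L (Algebra.norm (ZMod p) z) =
      ∏ i : Fin (Module.finrank (ZMod p) E), ∏ g : L ≃ₐ[E] L, g z ^ p ^ (i : ℕ) := by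
  have : Finite E := Finite.of_injective _ (algebraMap E L).injective
  rw [IsScalarTower.algebraMap_apply (ZMod p) E L, ← Algebra.norm_norm (S := E),
    FiniteField.algebraMap_norm_eq_prod_pow, map_prod, Finset.prod_range]
  refine Finset.prod_congr rfl fun i _ => ?_
  rw [map_pow, Algebra.norm_eq_prod_automorphisms, Nat.card_zmod, Finset.prod_pow]

/-- If the elements `ℓ_i`, as many as the degree of `E` over `𝔽_p`, are pairwise not conjugate
over `E`, then the equations `N(y + ℓ_i) = t` have few common solutions `y` in `E`. -/
lemma card_le_of_forall_norm_eq {ι : Type*} [Fintype ι]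
    (hι : Fintype.card ι = Module.finrank (ZMod p) E) {ℓ : ι → L}
    (hℓ : ∀ i i', i ≠ i' → ∀ g : L ≃ₐ[E] L, ℓ i ≠ g (ℓ i')) (t : ZMod p) (Y : Finset E)
    (hY : ∀ y ∈ Y, ∀ i, Algebra.norm (ZMod p) (algebraMap E L y + ℓ i) = t) :
    Y.card ≤ (Module.finrank (ZMod p) E)! * Module.finrank E L ^ Module.finrank (ZMod p) E := by
  classical
  have : Finite E := Finite.of_injective _ (algebraMap E L).injective
  have : CharP L p := charP_of_injective_algebraMap (algebraMap (ZMod p) L).injective p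
  set m := Module.finrank (ZMod p) E with hm
  have hm0 : 0 < m := Module.finrank_pos
  let e : Fin m ≃ ι := (Fintype.equivFinOfCardEq hι).symm
  -- As `g` fixes `y`, the factors of `N(y + ℓ_i)` are `y ^ p ^ j + (g ℓ_i) ^ p ^ j`; the powers `y
  -- ^ p ^ j` are treated as independent unknowns.
  let a : Fin m → Fin m → (L ≃ₐ[E] L) → L := fun i j g => -(g (ℓ (e i))) ^ p ^ (j : ℕ)
  have ha : ∀ i i' j l l', i ≠ i' → a i j l ≠ a i' j l' := by
    intro i i' j l l' hne h
    have h1 : (l (ℓ (e i)) - l' (ℓ (e i'))) ^ p ^ (j : ℕ) = 0 := by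
      rw [sub_pow_char_pow, neg_injective h, sub_self]
    have h2 : l (ℓ (e i)) = l' (ℓ (e i')) := sub_eq_zero.1 (eq_zero_of_pow_eq_zero h1)
    refine hℓ (e i) (e i') (e.injective.ne hne) (l'.trans l.symm) ?_
    rw [AlgEquiv.trans_apply, ← h2, AlgEquiv.symm_apply_apply]
  let S : Finset (Fin m → L) := Y.image fun y j => algebraMap E L y ^ p ^ (j : ℕ)
  have hS : ∀ x ∈ S, ∀ i, ∏ j, ∏ l, (x j - a i j l) = algebraMap (ZMod p) L t := by
    intro x hx i
    obtain ⟨y, hy, rfl⟩ := Finset.mem_image.1 hx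
    rw [← hY y hy (e i), algebraMap_norm_eq_prod_prod p (E := E)]
    refine Finset.prod_congr rfl fun j _ => Finset.prod_congr rfl fun g _ => ?_
    rw [map_add, AlgEquiv.commutes, add_pow_char_pow, sub_neg_eq_add]
  -- Coordinate 0 is `y ^ p ^ 0 = y`, so its number of values is `Y.card`.
  have hcard := card_image_le_of_forall_prod_eq ha _ ⟨0, hm0⟩ S hS
  rw [Finset.image_image, Finset.card_image_of_injective, Fintype.card_fin,
    ← Nat.card_eq_fintype_card, IsGalois.card_aut_eq_finrank] at hcard
  · exact hcard
  · intro y y' h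
    simpa using h

end Norm

/-! ### The linear forms `L_i` -/

section Forms

variable {E L : Type*} [Field E] [Field L] [Algebra E L] {k : ℕ} {α : Fin (k + 1) → L}

lemma GeneralPosition.ne_zero (hα : GeneralPosition E α) (hk : 1 ≤ k) (i : Fin (k + 1)) :
    α i ≠ 0 := by
  have : Nontrivial (Fin (k + 1)) := Fin.nontrivial_iff_two_le.2 (by lia)
  obtain ⟨j, hj⟩ := exists_ne i
  exact (hα j).ne_zero ⟨i, hj.symm⟩

lemma mul_add_linForm {i : Fin (k + 1)} (hi : α i ≠ 0) (x : Fin (k + 1) → E) :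
    α i * (algebraMap E L (x i) + linForm α i x) = ∑ j, α j * algebraMap E L (x j) := by
  classical
  rw [← Finset.add_sum_erase _ _ (Finset.mem_univ i), mul_add, linForm, Finset.mul_sum]
  congr 1
  refine Finset.sum_congr rfl fun j _ => ?_
  field_simp

lemma linForm_congr {i : Fin (k + 1)} {x y : Fin (k + 1) → E} (h : ∀ j, j ≠ i → x j = y j) :
    linForm α i x = linForm α i y :=
  Finset.sum_congr rfl fun j hj => by rw [h j (Finset.ne_of_mem_erase hj)]

/-- `linForm` as a linear map. -/
noncomputable def linFormHom (α : Fin (k + 1) → L) (i : Fin (k + 1)) :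
    (Fin (k + 1) → E) →ₗ[E] L where
  toFun := linForm α i
  map_add' x y := by simp [linForm, mul_add, Finset.sum_add_distrib]
  map_smul' c x := by
    rw [RingHom.id_apply, Algebra.smul_def c (linForm α i x)]
    simp only [linForm, Pi.smul_apply, smul_eq_mul, map_mul, Finset.mul_sum]
    exact Finset.sum_congr rfl fun j _ => by ring

/-- `α_i L_i` is a combination of the independent `α_j`, `j ≠ i`, so its value determines their
coefficients. -/
lemma GeneralPosition.eq_of_linForm_eq (hα : GeneralPosition E α) (hk : 1 ≤ k)
    {i : Fin (k + 1)} {x y : Fin (k + 1) → E} (h : linForm α i x = linForm α i y)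
    {j : Fin (k + 1)} (hj : j ≠ i) : x j = y j := by
  classical
  have h0 : linForm α i (x - y) = 0 := by
    rw [← sub_eq_zero] at h
    rw [← h]
    exact map_sub (linFormHom α i) x y
  have h1 : ∑ j : {j // j ≠ i}, (x - y) j.1 • α j.1 = 0 := by
    have h2 : α i * linForm α i (x - y) = 0 := by rw [h0, mul_zero]
    rw [linForm, Finset.mul_sum, Finset.sum_subtype (p := fun j => j ≠ i) _ (by simp)] at h2
    rw [← h2]
    refine Finset.sum_congr rfl fun j _ => ?_
    have := hα.ne_zero hk i
    rw [Algebra.smul_def]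
    field_simp
  exact sub_eq_zero.1 (Fintype.linearIndependent_iff.1 (hα i) _ h1 ⟨j, hj⟩)

end Forms

/-! ### Copies of `K` in partite hypergraphs -/

lemma mem_transversal {d : ℕ} {P : Fin d → Type*} {x : ∀ i, P i} {u : Σ i, P i} :
    u ∈ transversal x ↔ ⟨u.1, x u.1⟩ = u := by
  simp only [transversal, Finset.mem_map, Finset.mem_univ, true_and]
  exact ⟨by rintro ⟨i, rfl⟩; rfl, fun h => ⟨_, h⟩⟩

lemma transversal_injective {d : ℕ} {P : Fin d → Type*} :
    Function.Injective (transversal : (∀ i, P i) → Finset (Σ i, P i)) := by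
  intro x y h
  funext i
  have h1 : (⟨i, x i⟩ : Σ i, P i) ∈ transversal y := h ▸ mem_transversal.2 rfl
  simpa using (mem_transversal.1 h1).symm

lemma card_transversal {d : ℕ} {P : Fin d → Type*} (x : ∀ i, P i) : (transversal x).card = d := by
  simp [transversal]

/-- A copy of a complete `d`-partite hypergraph in a `d`-partite hypergraph respects the
partitions up to a permutation of the parts. -/
lemma exists_perm_of_forall_map_transversal {d : ℕ} {s : Fin d → ℕ} (hs : ∀ i, 0 < s i)
    {V : Type*} (f : (Σ i, Fin (s i)) ↪ (Σ _ : Fin d, V)) {Z : Set (Fin d → V)}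
    (hf : ∀ x : ∀ i, Fin (s i), ∃ z ∈ Z, (transversal x).map f = transversal z) :
    ∃ τ : Equiv.Perm (Fin d), (∀ u, (f u).1 = τ u.1) ∧
      ∀ x : ∀ i, Fin (s i), (fun j => (f ⟨τ.symm j, x (τ.symm j)⟩).2) ∈ Z := by
  classical
  have hinj : ∀ x : ∀ i, Fin (s i), Function.Injective fun i => (f ⟨i, x i⟩).1 := by
    intro x i i' h
    obtain ⟨z, -, hz⟩ := hf x
    have hmem : ∀ i, (⟨(f ⟨i, x i⟩).1, z (f ⟨i, x i⟩).1⟩ : Σ _ : Fin d, V) = f ⟨i, x i⟩ := by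
      intro i
      rw [← mem_transversal, ← hz]
      exact Finset.mem_map_of_mem _ (mem_transversal.2 rfl)
    have h1 : f ⟨i, x i⟩ = f ⟨i', x i'⟩ := by
      rw [← hmem i, ← hmem i']
      change (f ⟨i, x i⟩).1 = (f ⟨i', x i'⟩).1 at h
      rw [h]
    exact congrArg Sigma.fst (f.injective h1)
  let x₀ : ∀ i, Fin (s i) := fun i => ⟨0, hs i⟩
  let τ : Equiv.Perm (Fin d) := Equiv.ofBijective _ (Finite.injective_iff_bijective.1 (hinj x₀))
  have hτ : ∀ u, (f u).1 = τ u.1 := by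
    rintro ⟨i, c⟩
    obtain ⟨i', hi'⟩ := τ.surjective (f ⟨i, c⟩).1
    by_cases hii : i' = i
    · rw [← hi', hii]
    · exfalso
      apply hii
      -- Were `f ⟨i, c⟩` in the part assigned to `i' ≠ i`, this edge would meet that part twice.
      apply hinj (Function.update x₀ i c)
      simp only [Function.update_self, Function.update_of_ne hii]
      exact hi'
  refine ⟨τ, hτ, fun x => ?_⟩
  obtain ⟨z, hz, hz'⟩ := hf x
  convert hz using 1
  funext j
  have h1 : f ⟨τ.symm j, x (τ.symm j)⟩ ∈ transversal z := by
    rw [← hz']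
    exact Finset.mem_map_of_mem _ (mem_transversal.2 rfl)
  have h2 := mem_transversal.1 h1
  rw [← h2]
  simp [hτ]

lemma normHypergraph_sized (p : ℕ) {E L : Type*} [Field E] [Field L] [Algebra E L]
    [Algebra (ZMod p) L] {d : ℕ} (α : Fin d → L) (F : Finset (Fin d → E)) (t : ZMod p) :
    (normHypergraph p α F t : Set (Finset (Σ _ : Fin d, E))).Sized d := by
  classical
  intro e he
  obtain ⟨x, -, rfl⟩ := Finset.mem_image.1 (Finset.mem_coe.1 he)
  exact card_transversal x

lemma card_normHypergraph (p : ℕ) {E L : Type*} [Field E] [Field L] [Algebra E L]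
    [Algebra (ZMod p) L] {d : ℕ} (α : Fin d → L) (F : Finset (Fin d → E))
    (t : ZMod p) :
    (normHypergraph p α F t).card = (F.filter fun x =>
      Algebra.norm (ZMod p) (∑ j, α j * algebraMap E L (x j)) = t).card := by
  classical
  rw [normHypergraph]
  convert Finset.card_image_of_injective _ transversal_injective

/-! ### Norm hypergraphs contain no copy of `K` -/

section Free

variable (p : ℕ) [Fact p.Prime] {E L : Type*} [Field E] [Field L] [Finite L]
  [Algebra (ZMod p) E] [Algebra (ZMod p) L] [Algebra E L] [IsScalarTower (ZMod p) E L]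
  {k : ℕ} {α : Fin (k + 1) → L}

theorem not_containsCopy_normHypergraph (hk : 1 ≤ k) (s : Fin (k + 1) → ℕ) (hs : ∀ i, 0 < s i)
    (hE : Module.finrank (ZMod p) E = ∏ i : Fin k, s i.castSucc)
    (hlast : (Module.finrank (ZMod p) E)! * Module.finrank E L ^ Module.finrank (ZMod p) E <
      s (Fin.last k))
    (hα : GeneralPosition E α) {F : Finset (Fin (k + 1) → E)} (hF : GaloisSeparated α F)
    (t : ZMod p) :
    ¬ ContainsCopy (completePartite s) (normHypergraph p α F t) := by
  classical
  rintro ⟨f, hf⟩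
  obtain ⟨τ, hτ, hZ⟩ := exists_perm_of_forall_map_transversal hs f
    (Z := {z | z ∈ F ∧ Algebra.norm (ZMod p) (∑ j, α j * algebraMap E L (z j)) = t}) (by
      intro x
      have h1 := hf (transversal x) (Finset.mem_image_of_mem _ (Finset.mem_univ x))
      obtain ⟨z, hz, hz'⟩ := Finset.mem_image.1 h1
      exact ⟨z, Finset.mem_filter.1 hz, hz'.symm⟩)
  have hfinj : ∀ i c c', (f ⟨i, c⟩).2 = (f ⟨i, c'⟩).2 → c = c' := by
    intro i c c' h
    have h1 : f ⟨i, c⟩ = f ⟨i, c'⟩ :=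
      Sigma.ext ((hτ _).trans (hτ ⟨i, c'⟩).symm) (heq_of_eq h)
    simpa using f.injective h1
  let full : (∀ i : Fin k, Fin (s i.castSucc)) → Fin (s (Fin.last k)) → ∀ i, Fin (s i) :=
    fun x c => Fin.snoc (α := fun i => Fin (s i)) x c
  let z : (∀ i : Fin k, Fin (s i.castSucc)) → Fin (s (Fin.last k)) → Fin (k + 1) → E :=
    fun x c j => (f ⟨τ.symm j, full x c (τ.symm j)⟩).2
  have hzF : ∀ x c, z x c ∈ F := fun x c => (hZ (full x c)).1
  have hzN : ∀ x c, Algebra.norm (ZMod p) (∑ j, α j * algebraMap E L (z x c j)) = t :=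
    fun x c => (hZ (full x c)).2
  set i₀ := τ (Fin.last k) with hi₀
  have hz_last : ∀ x c, z x c i₀ = (f ⟨Fin.last k, c⟩).2 := by
    intro x c
    simp only [z, full]
    rw [hi₀, Equiv.symm_apply_apply, Fin.snoc_last]
  have hz_cast : ∀ x c (i : Fin k), z x c (τ i.castSucc) = (f ⟨i.castSucc, x i⟩).2 := by
    intro x c i
    simp only [z, full]
    rw [Equiv.symm_apply_apply, Fin.snoc_castSucc]
  have hcases : ∀ j, j ≠ i₀ → ∃ i : Fin k, j = τ i.castSucc := by
    intro j hj
    have h1 : τ.symm j ≠ Fin.last k := by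
      intro h
      exact hj (by rw [hi₀, ← h, Equiv.apply_symm_apply])
    obtain ⟨i, hi⟩ := Fin.exists_castSucc_eq.2 h1
    exact ⟨i, by rw [hi, Equiv.apply_symm_apply]⟩
  let c₀ : Fin (s (Fin.last k)) := ⟨0, hs _⟩
  -- The choice of `c₀` is immaterial: `L_{i₀}` ignores coordinate `i₀`, the only one depending on
  -- the last class.
  let ℓ : (∀ i : Fin k, Fin (s i.castSucc)) → L := fun x => linForm α i₀ (z x c₀)
  have hℓ_eq : ∀ x c, linForm α i₀ (z x c) = ℓ x := by
    intro x c
    refine linForm_congr fun j hj => ?_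
    obtain ⟨i, rfl⟩ := hcases j hj
    rw [hz_cast, hz_cast]
  have hα0 := hα.ne_zero hk i₀
  -- General position excludes `g = 1`, separation every other `g`.
  have hℓ : ∀ x x', x ≠ x' → ∀ g : L ≃ₐ[E] L, ℓ x ≠ g (ℓ x') := by
    intro x x' hne g
    by_cases hg : g = 1
    · rw [hg, AlgEquiv.one_apply]
      intro h
      apply hne
      funext i
      have hi : τ i.castSucc ≠ i₀ := τ.injective.ne (Fin.castSucc_lt_last i).ne
      have h1 := hα.eq_of_linForm_eq hk h hi
      rw [hz_cast, hz_cast] at h1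
      exact hfinj _ _ _ h1
    · exact hF i₀ g hg _ (hzF x c₀) _ (hzF x' c₀)
  have hcard := card_le_of_forall_norm_eq p (E := E) (by
      rw [hE, Fintype.card_pi]; simp) hℓ (t / Algebra.norm (ZMod p) (α i₀))
    (Finset.univ.image fun c : Fin (s (Fin.last k)) => (f ⟨Fin.last k, c⟩).2) (by
      intro y hy x
      obtain ⟨c, -, rfl⟩ := Finset.mem_image.1 hy
      have h1 := hzN x c
      rw [← mul_add_linForm hα0, map_mul, hz_last, hℓ_eq] at h1
      rw [← h1, mul_div_cancel_left₀]
      exact Algebra.norm_ne_zero_iff.2 hα0)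
  rw [Finset.card_image_of_injective _ fun c c' h => hfinj _ _ _ h, Finset.card_univ,
    Fintype.card_fin] at hcard
  exact absurd hlast (not_lt.2 hcard)

end Free

/-! ### Dense separated sets and dense norm hypergraphs -/

section Dense

variable {E L : Type*} [Field E] [Field L] [Algebra E L] {k : ℕ}

/-- The witness is a basis together with the sum of its members. -/
lemma exists_generalPosition [FiniteDimensional E L] (h : Module.finrank E L = k) :
    ∃ α : Fin (k + 1) → L, GeneralPosition E α := by
  classical
  let b := Module.finBasisOfFinrankEq E L h
  refine ⟨Fin.snoc (α := fun _ => L) b (∑ i, b i), fun i => ?_⟩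
  rw [Fintype.linearIndependent_iff]
  intro c hc
  let c' : Fin (k + 1) → E := fun j => if hj : j ≠ i then c ⟨j, hj⟩ else 0
  have hsum : ∑ j, c' j • Fin.snoc (α := fun _ => L) b (∑ i, b i) j = 0 := by
    rw [← Finset.add_sum_erase _ _ (Finset.mem_univ i),
      Finset.sum_subtype (p := fun j => j ≠ i) _ (by simp), ← hc]
    have : c' i = 0 := by simp [c']
    rw [this, zero_smul, zero_add]
    refine Finset.sum_congr rfl fun j _ => ?_
    simp only [c', dif_pos j.2]
  rw [Fin.sum_univ_castSucc] at hsum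
  simp only [Fin.snoc_castSucc, Fin.snoc_last] at hsum
  rw [Finset.smul_sum, ← Finset.sum_add_distrib] at hsum
  simp only [← add_smul] at hsum
  have h1 := Fintype.linearIndependent_iff.1 b.linearIndependent _ hsum
  have hi : c' i = 0 := by simp [c']
  have hlast : c' (Fin.last k) = 0 := by
    rcases Fin.eq_castSucc_or_eq_last i with ⟨j, rfl⟩ | rfl
    · simpa [hi] using h1 j
    · exact hi
  intro j
  have hj : c' j = 0 := by
    rcases Fin.eq_castSucc_or_eq_last j.1 with ⟨l, hl⟩ | hl
    · rw [hl]
      simpa [hlast] using h1 l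
    · rw [hl, hlast]
  simpa [c', j.2] using hj

lemma GeneralPosition.linForm_surjective [FiniteDimensional E L] {α : Fin (k + 1) → L}
    (hα : GeneralPosition E α) (hk : 1 ≤ k) (h : Module.finrank E L = k) (i : Fin (k + 1)) :
    Function.Surjective (linForm (E := E) α i) := by
  classical
  intro z
  have : Nonempty {j : Fin (k + 1) // j ≠ i} := by
    have : Nontrivial (Fin (k + 1)) := Fin.nontrivial_iff_two_le.2 (by lia)
    obtain ⟨j, hj⟩ := exists_ne i
    exact ⟨⟨j, hj⟩⟩
  let b := basisOfLinearIndependentOfCardEqFinrank (hα i) (by simp [h])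
  refine ⟨fun j => if hj : j ≠ i then b.repr (α i * z) ⟨j, hj⟩ else 0, ?_⟩
  have h0 := hα.ne_zero hk i
  apply mul_left_cancel₀ h0
  rw [linForm, Finset.mul_sum, Finset.sum_subtype (p := fun j => j ≠ i) _ (by simp)]
  conv_rhs => rw [← b.sum_repr (α i * z)]
  refine Finset.sum_congr rfl fun j _ => ?_
  rw [Algebra.smul_def, dif_pos j.2, coe_basisOfLinearIndependentOfCardEqFinrank]
  field_simp

lemma card_ker_le [Finite E] [FiniteDimensional E L] {T : (Fin (k + 1) → E) →ₗ[E] L}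
    (hT : T ≠ 0) : Nat.card (LinearMap.ker T) ≤ Nat.card E ^ k := by
  have h1 : Module.finrank E (LinearMap.ker T) < k + 1 := by
    have := Submodule.finrank_lt (mt LinearMap.ker_eq_top.1 hT)
    simpa using this
  rw [Module.natCard_eq_pow_finrank (K := E)]
  exact Nat.pow_le_pow_right Nat.card_pos (Nat.lt_succ_iff.1 h1)

/-- Few tuples `x` have `∑ α_j x_j = 0` or have some `L_i(x)` in a proper subfield. -/
lemma exists_card_ge_forall_ne [Finite L] {α : Fin (k + 1) → L}
    (hα : GeneralPosition E α) (hk : 1 ≤ k) (h : Module.finrank E L = k)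
    (hq : 2 * k ^ 2 ≤ Nat.card E) :
    ∃ G : Finset (Fin (k + 1) → E), Nat.card E ^ (k + 1) ≤ 2 * G.card ∧
      (∀ x ∈ G, ∑ j, α j * algebraMap E L (x j) ≠ 0) ∧
      ∀ x ∈ G, ∀ i, ∀ g : L ≃ₐ[E] L, g ≠ 1 → g (linForm α i x) ≠ linForm α i x := by
  classical
  have : Finite E := Finite.of_injective _ (algebraMap E L).injective
  have := Fintype.ofFinite E
  set q := Nat.card E with hqdef
  let T : Option (Fin (k + 1) × {g : L ≃ₐ[E] L // g ≠ 1}) → (Fin (k + 1) → E) →ₗ[E] L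
    | none => ∑ j, (LinearMap.mulLeft E (α j)) ∘ₗ (Algebra.linearMap E L) ∘ₗ LinearMap.proj j
    | some c => (c.2.1.toLinearMap - LinearMap.id) ∘ₗ linFormHom α c.1
  have hT_none : ∀ x, T none x = ∑ j, α j * algebraMap E L (x j) := fun x => by
    simp [T]
  have hT_some : ∀ c x, T (some c) x = c.2.1 (linForm α c.1 x) - linForm α c.1 x :=
    fun c x => rfl
  have hT : ∀ o, T o ≠ 0 := by
    rintro (_ | ⟨i, g, hg⟩) h0
    · have h1 : T none (Pi.single 0 1) = 0 := by rw [h0]; rfl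
      rw [hT_none, Finset.sum_eq_single 0] at h1
      · simp [hα.ne_zero hk 0] at h1
      · intro j _ hj
        simp [Pi.single_eq_of_ne hj]
      · simp
    · apply hg
      ext z
      obtain ⟨x, rfl⟩ := hα.linForm_surjective hk h i z
      have h1 : T (some (i, ⟨g, hg⟩)) x = 0 := by rw [h0]; rfl
      exact sub_eq_zero.1 ((hT_some _ _).symm.trans h1)
  let bad : Finset (Fin (k + 1) → E) :=
    Finset.univ.biUnion fun o => Finset.univ.filter fun x => T o x = 0
  -- There are `1 + (k + 1)(k - 1) = k^2` nonzero linear maps, each with kernel of size at most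
  -- `q^k`.
  have hbad : bad.card ≤ k ^ 2 * q ^ k := by
    have h1 : bad.card ≤ Finset.card (Finset.univ :
        Finset (Option (Fin (k + 1) × {g : L ≃ₐ[E] L // g ≠ 1}))) * q ^ k := by
      refine Finset.card_biUnion_le_card_mul _ _ _ fun o _ => ?_
      refine le_trans (le_of_eq ?_) (card_ker_le (hT o))
      rw [Nat.card_eq_fintype_card, ← Fintype.card_subtype]
      exact Fintype.card_congr (Equiv.refl _)
    refine h1.trans_eq ?_
    congr 1
    have h2 : Fintype.card (L ≃ₐ[E] L) = k := by
      rw [← Nat.card_eq_fintype_card, IsGalois.card_aut_eq_finrank, h]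
    rw [Finset.card_univ, Fintype.card_option, Fintype.card_prod, Fintype.card_fin,
      Fintype.card_subtype_compl, Fintype.card_subtype_eq, h2]
    obtain ⟨k, rfl⟩ := Nat.exists_eq_add_of_le' hk
    rw [Nat.add_sub_cancel]
    ring
  refine ⟨badᶜ, ?_, fun x hx => ?_, fun x hx i g hg => ?_⟩
  · have h1 : bad.card + badᶜ.card = q ^ (k + 1) := by
      rw [Finset.card_add_card_compl, Fintype.card_pi, hqdef, Nat.card_eq_fintype_card]
      simp
    have h2 : 2 * (k ^ 2 * q ^ k) ≤ q ^ (k + 1) := by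
      rw [pow_succ q, mul_comm (q ^ k) q, ← mul_assoc]
      exact Nat.mul_le_mul_right _ hq
    lia
  · intro h0
    exact Finset.mem_compl.1 hx (Finset.mem_biUnion.2 ⟨none, Finset.mem_univ _,
      Finset.mem_filter.2 ⟨Finset.mem_univ _, (hT_none x).trans h0⟩⟩)
  · intro h0
    exact Finset.mem_compl.1 hx (Finset.mem_biUnion.2 ⟨some (i, ⟨g, hg⟩), Finset.mem_univ _,
      Finset.mem_filter.2 ⟨Finset.mem_univ _, (hT_some _ x).trans (sub_eq_zero.2 h0)⟩⟩)

/-- A group action has a colouring by group elements such that two points of one colour and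
one orbit are equal. -/
lemma exists_orbit_coloring (G X : Type*) [Group G] [MulAction G X] :
    ∃ γ : X → G, ∀ x y, ∀ g : G, γ x = γ y → x = g • y → x = y := by
  have h1 : ∀ x : X, ∃ g : G, g • (Quotient.out (Quotient.mk (MulAction.orbitRel G X) x)) = x := by
    intro x
    have := Quotient.mk_out (s := MulAction.orbitRel G X) x
    exact MulAction.orbitRel_apply.1 ((MulAction.orbitRel G X).symm this)
  choose γ hγ using h1
  refine ⟨γ, fun x y g hxy hg => ?_⟩
  have h2 : Quotient.mk (MulAction.orbitRel G X) x = Quotient.mk (MulAction.orbitRel G X) y :=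
    Quotient.sound ⟨g, hg.symm⟩
  rw [← hγ x, ← hγ y, hxy, h2]

/-- Colour `x` by the orbit colours of all `L_i(x)`, using `k^(k+1)` colours, and keep a largest
class. Inside it `L_i(x) = g(L_i(y))` forces `L_i(x) = L_i(y)`, a value fixed by `g ≠ 1`, which the
good set excludes. -/
theorem exists_galoisSeparated [Finite L] {α : Fin (k + 1) → L}
    (hα : GeneralPosition E α) (hk : 1 ≤ k) (h : Module.finrank E L = k)
    (hq : 2 * k ^ 2 ≤ Nat.card E) :
    ∃ F : Finset (Fin (k + 1) → E), GaloisSeparated α F ∧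
      (∀ x ∈ F, ∑ j, α j * algebraMap E L (x j) ≠ 0) ∧
      1 / (2 * (k : ℝ) ^ (k + 1)) * (Nat.card E : ℝ) ^ (k + 1) ≤ F.card := by
  classical
  have : Finite E := Finite.of_injective _ (algebraMap E L).injective
  obtain ⟨G, hGcard, hG0, hG⟩ := exists_card_ge_forall_ne hα hk h hq
  obtain ⟨γ, hγ⟩ := exists_orbit_coloring (L ≃ₐ[E] L) L
  have hcard : Fintype.card (Fin (k + 1) → (L ≃ₐ[E] L)) = k ^ (k + 1) := by
    rw [Fintype.card_fun, Fintype.card_fin, ← Nat.card_eq_fintype_card,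
      IsGalois.card_aut_eq_finrank, h]
  have hk0 : (0 : ℝ) < k := by exact_mod_cast hk
  obtain ⟨c, -, hc⟩ := Finset.exists_le_card_fiber_of_nsmul_le_card_of_maps_to
    (s := G) (t := (Finset.univ : Finset (Fin (k + 1) → (L ≃ₐ[E] L))))
    (f := fun x i => γ (linForm α i x))
    (b := 1 / (2 * (k : ℝ) ^ (k + 1)) * (Nat.card E : ℝ) ^ (k + 1))
    (fun _ _ => Finset.mem_univ _) Finset.univ_nonempty (by
      rw [Finset.card_univ, hcard, nsmul_eq_mul]
      push_cast
      have h1 : ((Nat.card E : ℝ)) ^ (k + 1) ≤ 2 * G.card := by exact_mod_cast hGcard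
      have h2 : (k : ℝ) ^ (k + 1) * (1 / (2 * (k : ℝ) ^ (k + 1)) * (Nat.card E : ℝ) ^ (k + 1)) =
        (Nat.card E : ℝ) ^ (k + 1) / 2 := by field_simp
      rw [h2]
      linarith)
  refine ⟨_, ?_, fun x hx => hG0 x (Finset.mem_filter.1 hx).1, hc⟩
  intro i g hg x hx y hy hxy
  obtain ⟨hxG, hxc⟩ := Finset.mem_filter.1 hx
  obtain ⟨hyG, hyc⟩ := Finset.mem_filter.1 hy
  have h1 : linForm α i x = linForm α i y :=
    hγ _ _ g ((congrFun hxc i).trans (congrFun hyc i).symm) hxy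
  rw [h1] at hxy
  exact hG y hyG i g hg hxy.symm

lemma exists_card_normHypergraph_ge (p : ℕ) [Fact p.Prime] [Finite L] [Algebra (ZMod p) L]
    {α : Fin (k + 1) → L} {F : Finset (Fin (k + 1) → E)}
    (hF : ∀ x ∈ F, ∑ j, α j * algebraMap E L (x j) ≠ 0) :
    ∃ t : ZMod p, t ≠ 0 ∧ (F.card : ℝ) / p ≤ (normHypergraph p α F t).card := by
  classical
  have hp : (0 : ℝ) < p := by exact_mod_cast (Fact.out : p.Prime).pos
  obtain ⟨t, ht, hc⟩ := Finset.exists_le_card_fiber_of_nsmul_le_card_of_maps_to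
    (s := F) (t := (Finset.univ.erase 0 : Finset (ZMod p)))
    (f := fun x => Algebra.norm (ZMod p) (∑ j, α j * algebraMap E L (x j)))
    (b := (F.card : ℝ) / p)
    (fun x hx => Finset.mem_erase.2 ⟨Algebra.norm_ne_zero_iff.2 (hF x hx), Finset.mem_univ _⟩)
    ⟨1, by simp⟩ (by
      rw [nsmul_eq_mul, mul_div_assoc', div_le_iff₀ hp, mul_comm]
      refine mul_le_mul_of_nonneg_left ?_ (Nat.cast_nonneg _)
      have h1 := Finset.card_le_univ (Finset.univ.erase 0 : Finset (ZMod p))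
      rw [ZMod.card] at h1
      exact_mod_cast h1)
  refine ⟨t, Finset.ne_of_mem_erase ht, ?_⟩
  rw [card_normHypergraph]
  exact hc

/-- Since `m ≥ 2^k`, this makes `q = p^m` large enough for every prime `p`, so small primes need no
separate treatment. -/
lemma two_mul_sq_le_two_pow_two_pow (k : ℕ) : 2 * k ^ 2 ≤ 2 ^ 2 ^ k := by
  rcases lt_or_ge k 3 with hk | hk
  · interval_cases k <;> norm_num
  · have h1 : k ^ 2 ≤ 2 ^ (2 * k) := by
      rw [mul_comm, pow_mul]
      exact Nat.pow_le_pow_left Nat.lt_two_pow_self.le 2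
    have h2 : 2 * k + 1 ≤ 2 ^ k := by
      induction k, hk using Nat.le_induction with
      | base => norm_num
      | succ n hn ih =>
        have h3 : n ^ 2 ≤ 2 ^ (2 * n) := by
          rw [mul_comm, pow_mul]
          exact Nat.pow_le_pow_left Nat.lt_two_pow_self.le 2
        have := ih h3
        rw [pow_succ]
        lia
    calc 2 * k ^ 2 ≤ 2 * 2 ^ (2 * k) := Nat.mul_le_mul_left _ h1
      _ = 2 ^ (2 * k + 1) := by ring
      _ ≤ 2 ^ 2 ^ k := Nat.pow_le_pow_right (by norm_num) h2

end Dense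

/-! ### Upper bound: densities of blow-ups -/

section Blowup

universe u

variable {V : Type u} [Finite V]

/-- Replacing one vertex class by `s` copies raises the density of a bipartite relation at most to
the power `s`. -/
lemma density_pow_le_density_blowup {W : Type u} [Finite W] (P : V → W → Prop) {s : ℕ}
    (hs : 0 < s) :
    ((Nat.card {z : V × W // P z.1 z.2} : ℝ) / (Nat.card V * Nat.card W)) ^ s ≤
      (Nat.card {z : (Fin s → V) × W // ∀ c, P (z.1 c) z.2} : ℝ) /
        (Nat.card V ^ s * Nat.card W) := by
  classical
  have := Fintype.ofFinite W
  obtain ⟨r, rfl⟩ := Nat.exists_eq_add_of_le' hs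
  let D : W → ℝ := fun w => Nat.card {v // P v w}
  have h1 : (Nat.card {z : V × W // P z.1 z.2} : ℝ) ≤ ∑ w, D w := by
    have h : Nat.card {z : V × W // P z.1 z.2} ≤ Nat.card (Σ w, {v // P v w}) :=
      Nat.card_le_card_of_injective (fun z => ⟨z.1.2, z.1.1, z.2⟩) (by
        rintro ⟨⟨v, w⟩, hz⟩ ⟨⟨v', w'⟩, hz'⟩ h
        simp only [Sigma.mk.injEq] at h
        obtain ⟨rfl, h⟩ := h
        simpa using h)
    rw [Nat.card_sigma] at h
    simp only [D]
    exact_mod_cast h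
  have h2 : ∑ w, D w ^ (r + 1) ≤
      (Nat.card {z : (Fin (r + 1) → V) × W // ∀ c, P (z.1 c) z.2} : ℝ) := by
    have h : Nat.card (Σ w, (Fin (r + 1) → {v // P v w})) ≤
        Nat.card {z : (Fin (r + 1) → V) × W // ∀ c, P (z.1 c) z.2} :=
      Nat.card_le_card_of_injective (fun z => ⟨(fun c => (z.2 c).1, z.1), fun c => (z.2 c).2⟩) (by
        rintro ⟨w, f⟩ ⟨w', f'⟩ h
        simp only [Subtype.mk.injEq, Prod.mk.injEq] at h
        obtain ⟨h, rfl⟩ := h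
        congr 1
        funext c
        exact Subtype.ext (congrFun h c))
    rw [Nat.card_sigma] at h
    simp only [Nat.card_fun, Nat.card_fin] at h
    simp only [D]
    exact_mod_cast h
  -- Power mean inequality for the degrees.
  have h3 : (∑ w, D w) ^ (r + 1) / (Nat.card W : ℝ) ^ r ≤ ∑ w, D w ^ (r + 1) := by
    have := pow_sum_div_card_le_sum_pow (s := Finset.univ) (f := D)
      (fun w _ => Nat.cast_nonneg _) r
    rwa [Finset.card_univ, ← Nat.card_eq_fintype_card] at this
  calc _ ≤ ((∑ w, D w) / (Nat.card V * Nat.card W)) ^ (r + 1) := by gcongr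
    _ = ((∑ w, D w) ^ (r + 1) / (Nat.card W : ℝ) ^ r) / (Nat.card V ^ (r + 1) * Nat.card W) := by
        rw [div_pow, mul_pow, div_div]
        congr 1
        ring
    _ ≤ _ := by gcongr; exact h3.trans h2

/-- Replacing each vertex class but one by `s_i` copies raises the density of a multipartite
relation at most to the power `∏ s_i`. -/
lemma density_pow_prod_le_density_blowup {r : ℕ} (s : Fin r → ℕ) (hs : ∀ i, 0 < s i)
    {W : Type u} [Finite W] (P : (Fin r → V) → W → Prop) :
    ((Nat.card {z : (Fin r → V) × W // P z.1 z.2} : ℝ) / (Nat.card V ^ r * Nat.card W)) ^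
        (∏ i, s i) ≤
      (Nat.card {z : (∀ i, Fin (s i) → V) × W //
        ∀ c : ∀ i, Fin (s i), P (fun i => z.1 i (c i)) z.2} : ℝ) /
        (Nat.card V ^ (∑ i, s i) * Nat.card W) := by
  induction r generalizing W with
  | zero =>
    simp only [Finset.univ_eq_empty, Finset.prod_empty, Finset.sum_empty, pow_one, pow_zero]
    gcongr
    refine Nat.card_le_card_of_injective
      (fun z => ⟨(fun i => i.elim0, z.1.2), fun c => ?_⟩) ?_
    · convert z.2
    · rintro ⟨⟨x, w⟩, hz⟩ ⟨⟨x', w'⟩, hz'⟩ h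
      simp only [Subtype.mk.injEq, Prod.mk.injEq] at h
      obtain ⟨-, rfl⟩ := h
      congr 2
      exact Subsingleton.elim _ _
  | succ r ih =>
    -- The first class is absorbed into `W` while the others are blown up; `step` then blows up the
    -- first class against everything else.
    have ih' := ih (fun i => s i.succ) (fun i => hs _) (W := V × W)
      (fun x z => P (Fin.cons z.1 x) z.2)
    let A := ∀ i : Fin r, Fin (s i.succ) → V
    have hA : (Nat.card A : ℝ) = (Nat.card V : ℝ) ^ ∑ i : Fin r, s i.succ := by
      simp only [A, Nat.card_pi, Finset.prod_const, Finset.card_univ,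
        Fintype.card_fin, Finset.prod_pow_eq_pow_sum]
      push_cast
      rfl
    have step := density_pow_le_density_blowup (V := V) (W := A × W)
      (fun v z => ∀ c : ∀ i : Fin r, Fin (s i.succ),
        P (Fin.cons v fun i => z.1 i (c i)) z.2) (hs 0)
    have e1 : Nat.card {z : (Fin (r + 1) → V) × W // P z.1 z.2} ≤
        Nat.card {z : (Fin r → V) × (V × W) // P (Fin.cons z.2.1 z.1) z.2.2} :=
      Nat.card_le_card_of_injective
        (fun z => ⟨(Fin.tail z.1.1, (z.1.1 0, z.1.2)), by
          simpa [Fin.cons_self_tail] using z.2⟩) (by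
        rintro ⟨⟨x, w⟩, hz⟩ ⟨⟨x', w'⟩, hz'⟩ h
        simp only [Subtype.mk.injEq, Prod.mk.injEq] at h
        obtain ⟨h1, h2, rfl⟩ := h
        congr 2
        rw [← Fin.cons_self_tail x, ← Fin.cons_self_tail x', h1, h2])
    have e2 : Nat.card {z : A × (V × W) // ∀ c : ∀ i : Fin r, Fin (s i.succ),
          P (Fin.cons z.2.1 fun i => z.1 i (c i)) z.2.2} ≤
        Nat.card {z : V × (A × W) // ∀ c : ∀ i : Fin r, Fin (s i.succ),
          P (Fin.cons z.1 fun i => z.2.1 i (c i)) z.2.2} :=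
      Nat.card_le_card_of_injective
        (fun z => ⟨(z.1.2.1, (z.1.1, z.1.2.2)), z.2⟩) (by
        rintro ⟨⟨x, v, w⟩, hz⟩ ⟨⟨x', v', w'⟩, hz'⟩ h
        simp only [Subtype.mk.injEq, Prod.mk.injEq] at h
        obtain ⟨rfl, rfl, rfl⟩ := h
        rfl)
    have e3 : Nat.card {z : (Fin (s 0) → V) × (A × W) // ∀ c₀, ∀ c : ∀ i : Fin r, Fin (s i.succ),
          P (Fin.cons (z.1 c₀) fun i => z.2.1 i (c i)) z.2.2} ≤
        Nat.card {z : (∀ i, Fin (s i) → V) × W //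
          ∀ c : ∀ i, Fin (s i), P (fun i => z.1 i (c i)) z.2} :=
      Nat.card_le_card_of_injective
        (fun z => ⟨(Fin.cons (α := fun i => Fin (s i) → V) z.1.1 z.1.2.1, z.1.2.2), fun c => by
          convert z.2 (c 0) (fun i => c i.succ) using 1
          funext i
          refine Fin.cases ?_ (fun i => ?_) i <;> simp⟩) (by
        rintro ⟨⟨x, a, w⟩, hz⟩ ⟨⟨x', a', w'⟩, hz'⟩ h
        simp only [Subtype.mk.injEq, Prod.mk.injEq] at h
        obtain ⟨h1, rfl⟩ := h
        obtain ⟨rfl, rfl⟩ := Fin.cons_injective2 h1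
        rfl)
    rw [Fin.prod_univ_succ, Fin.sum_univ_succ, mul_comm (s 0), pow_mul]
    simp only [Nat.card_prod, Nat.cast_mul, hA] at ih' step
    refine le_trans (pow_le_pow_left₀ (by positivity) (le_trans ?_ ih') _)
      (le_trans (pow_le_pow_left₀ (by positivity) ?_ _) (step.trans ?_))
    · refine pow_le_pow_left₀ (by positivity) ?_ _
      rw [pow_succ, mul_assoc]
      gcongr
    · rw [mul_left_comm]
      gcongr
    · rw [pow_add, mul_assoc]
      gcongr

end Blowup

/-- Few functions are not injective. -/
lemma card_not_injective_mul_le {I V : Type*} [Finite I] [Finite V] :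
    Nat.card {a : I → V // ¬ Function.Injective a} * Nat.card V ≤
      Nat.card I ^ 2 * Nat.card V ^ Nat.card I := by
  classical
  have h1 : ∀ a : {a : I → V // ¬ Function.Injective a}, ∃ c : I × I, c.1 ≠ c.2 ∧
      a.1 c.1 = a.1 c.2 := by
    rintro ⟨a, ha⟩
    rw [Function.not_injective_iff] at ha
    obtain ⟨u, v, h, hne⟩ := ha
    exact ⟨(u, v), hne, h⟩
  choose c hc using h1
  rw [← Nat.card_prod, sq, ← Nat.card_prod, ← Nat.card_fun, ← Nat.card_prod]
  -- Overwriting `a` at one point of a colliding pair loses nothing: the old value survives at the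
  -- other point.
  refine Nat.card_le_card_of_injective
    (fun z => (c z.1, Function.update z.1.1 (c z.1).1 z.2)) ?_
  rintro ⟨a, t⟩ ⟨a', t'⟩ h
  simp only [Prod.mk.injEq] at h
  obtain ⟨h1, h2⟩ := h
  have ha := hc a
  have ha' := hc a'
  rw [← h1] at ha' h2
  have ht : t = t' := by simpa using congrFun h2 (c a).1
  have hne : ∀ u, u ≠ (c a).1 → a.1 u = a'.1 u := by
    intro u hu
    simpa [Function.update_of_ne hu] using congrFun h2 u
  refine Prod.ext (Subtype.ext (funext fun u => ?_)) ht
  by_cases hu : u = (c a).1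
  · change a.1 u = a'.1 u
    rw [hu, ha.2, ha'.2]
    exact hne _ ha.1.symm
  · exact hne u hu

section Upper

variable {V : Type*} [Finite V] {k : ℕ} {s : Fin (k + 1) → ℕ} {H : Finset (Finset V)}

-- Vertices of different classes stay distinct automatically: they lie in a common edge, which has
-- exactly `k + 1` elements. Hence the common neighbours need not be chosen to avoid the image of
-- `a`.
open Classical in
lemma containsCopy_of_injective (hs : ∀ i, 0 < s i) (hH : (H : Set (Finset V)).Sized (k + 1))
    {a : (Σ i : Fin k, Fin (s i.castSucc)) → V} (ha : Function.Injective a)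
    (hcard : s (Fin.last k) ≤ Nat.card {y : V // ∀ c : ∀ i : Fin k, Fin (s i.castSucc),
      Finset.univ.image (Fin.snoc (α := fun _ => V) (fun i => a ⟨i, c i⟩) y) ∈ H}) :
    ContainsCopy (completePartite s) H := by
  set Y := {y : V // ∀ c : ∀ i : Fin k, Fin (s i.castSucc),
      Finset.univ.image (Fin.snoc (α := fun _ => V) (fun i => a ⟨i, c i⟩) y) ∈ H}
  have := Fintype.ofFinite Y
  obtain ⟨y⟩ : Nonempty (Fin (s (Fin.last k)) ↪ Y) := by
    apply Function.Embedding.nonempty_of_card_le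
    rwa [Fintype.card_fin, ← Nat.card_eq_fintype_card]
  let f : (Σ i, Fin (s i)) → V := fun u =>
    Fin.snoc (α := fun i => Fin (s i) → V) (fun i c => a ⟨i, c⟩) (fun c => (y c).1) u.1 u.2
  have hf_cast : ∀ (i : Fin k) c, f ⟨i.castSucc, c⟩ = a ⟨i, c⟩ := fun i c => by simp [f]
  have hf_last : ∀ c, f ⟨Fin.last k, c⟩ = (y c).1 := fun c => by simp [f]
  have hedge : ∀ x : ∀ i, Fin (s i), Finset.univ.image (fun i => f ⟨i, x i⟩) ∈ H := by
    intro x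
    convert (y (x (Fin.last k))).2 fun i => x i.castSucc using 2
    funext i
    refine Fin.lastCases ?_ (fun i => ?_) i
    · rw [hf_last, Fin.snoc_last]
    · rw [hf_cast, Fin.snoc_castSucc]
  have hinj : ∀ x : ∀ i, Fin (s i), Function.Injective fun i => f ⟨i, x i⟩ := by
    intro x
    have h : (Finset.univ.image fun i => f ⟨i, x i⟩).card =
        (Finset.univ : Finset (Fin (k + 1))).card := by
      rw [hH (hedge x), Finset.card_univ, Fintype.card_fin]
    have h' := Finset.card_image_iff.1 h
    rwa [Finset.coe_univ, Set.injOn_univ] at h'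
  have hf : Function.Injective f := by
    rintro ⟨i, c⟩ ⟨i', c'⟩ h
    have hii : i = i' := by
      by_contra hne
      let x : ∀ i, Fin (s i) :=
        Function.update (Function.update (fun i => ⟨0, hs i⟩) i c) i' c'
      apply hne
      apply hinj x
      simp only [x, Function.update_self, Function.update_of_ne hne]
      exact h
    subst hii
    congr 1
    revert c c' h
    refine Fin.lastCases ?_ (fun i => ?_) i
    · intro c c' h
      rw [hf_last, hf_last] at h
      exact y.injective (Subtype.ext h)
    · intro c c' h
      rw [hf_cast, hf_cast] at h
      simpa using ha h
  refine ⟨⟨f, hf⟩, fun e he => ?_⟩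
  obtain ⟨x, -, rfl⟩ := Finset.mem_image.1 he
  convert hedge x using 1
  rw [transversal, Finset.map_map, Finset.map_eq_image]
  rfl

theorem density_pow_le_of_not_containsCopy [Nonempty V] (hs : ∀ i, 0 < s i)
    (hH : (H : Set (Finset V)).Sized (k + 1)) (hfree : ¬ ContainsCopy (completePartite s) H) :
    ((H.card : ℝ) / Nat.card V ^ (k + 1)) ^ (∏ i : Fin k, s i.castSucc) ≤
      ((s (Fin.last k) : ℝ) + (∑ i : Fin k, s i.castSucc : ℕ) ^ 2) / Nat.card V := by
  classical
  have := Fintype.ofFinite V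
  set n := Nat.card V with hn
  have hn0 : 0 < n := Nat.card_pos
  set I := Σ i : Fin k, Fin (s i.castSucc) with hI
  have hIcard : Nat.card I = ∑ i : Fin k, s i.castSucc := by
    rw [hI, Nat.card_sigma]; simp
  set S := ∑ i : Fin k, s i.castSucc with hS
  let P : (Fin k → V) → V → Prop := fun x y =>
    Finset.univ.image (Fin.snoc (α := fun _ => V) x y) ∈ H
  have h1 := density_pow_prod_le_density_blowup (fun i : Fin k => s i.castSucc)
    (fun i => hs _) P
  -- One ordering per edge suffices for the order of magnitude.
  have h2 : H.card ≤ Nat.card {z : (Fin k → V) × V // P z.1 z.2} := by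
    rw [← Fintype.card_coe, ← Nat.card_eq_fintype_card]
    refine Nat.card_le_card_of_surjective
      (fun z : {z : (Fin k → V) × V // P z.1 z.2} => (⟨_, z.2⟩ : H)) ?_
    rintro ⟨e, he⟩
    have hcard : e.card = k + 1 := hH he
    let x : Fin (k + 1) → V := fun i => ((e.equivFinOfCardEq hcard).symm i).1
    have hx : Finset.univ.image x = e := by
      ext v
      simp only [Finset.mem_image, Finset.mem_univ, true_and, x]
      constructor
      · rintro ⟨i, rfl⟩
        exact Subtype.prop _
      · intro hv
        exact ⟨e.equivFinOfCardEq hcard ⟨v, hv⟩, by simp⟩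
    refine ⟨⟨(Fin.init x, x (Fin.last k)), ?_⟩, ?_⟩
    · change Finset.univ.image _ ∈ H
      rw [Fin.snoc_init_self, hx]
      exact he
    · apply Subtype.ext
      change Finset.univ.image _ = e
      rw [Fin.snoc_init_self, hx]
  let Q : (I → V) → V → Prop := fun a y =>
    ∀ c : ∀ i : Fin k, Fin (s i.castSucc), P (fun i => a ⟨i, c i⟩) y
  have h3 : Nat.card {z : (∀ i : Fin k, Fin (s i.castSucc) → V) × V //
      ∀ c : ∀ i : Fin k, Fin (s i.castSucc), P (fun i => z.1 i (c i)) z.2} ≤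
      Nat.card (Σ a : I → V, {y // Q a y}) :=
    Nat.card_le_card_of_injective (fun z => ⟨fun u => z.1.1 u.1 u.2, z.1.2, z.2⟩) (by
      rintro ⟨⟨a, y⟩, hz⟩ ⟨⟨a', y'⟩, hz'⟩ h
      rw [Sigma.mk.injEq] at h
      obtain ⟨h, h'⟩ := h
      have haa : a = a' := by
        funext i c
        exact congrFun h ⟨i, c⟩
      subst haa
      simpa using h')
  have h4 : Nat.card (Σ a : I → V, {y // Q a y}) ≤ (s (Fin.last k) + S ^ 2) * n ^ S := by
    rw [Nat.card_sigma]
    calc ∑ a : I → V, Nat.card {y // Q a y}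
        ≤ ∑ a : I → V, (s (Fin.last k) + if ¬ Function.Injective a then n else 0) := by
          refine Finset.sum_le_sum fun a _ => ?_
          split_ifs with ha
          · rw [add_zero]
            by_contra! hlt
            exact hfree (containsCopy_of_injective hs hH ha hlt.le)
          · exact (Nat.card_le_card_of_injective _ Subtype.val_injective).trans
              (Nat.le_add_left _ _)
      _ = s (Fin.last k) * n ^ S + Nat.card {a : I → V // ¬ Function.Injective a} * n := by
          rw [Finset.sum_add_distrib, Finset.sum_const, Finset.card_univ,
            ← Nat.card_eq_fintype_card, Nat.card_fun, hIcard, smul_eq_mul, mul_comm,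
            ← Finset.sum_filter, Finset.sum_const, smul_eq_mul, ← Fintype.card_subtype,
            ← Nat.card_eq_fintype_card]
      _ ≤ s (Fin.last k) * n ^ S + S ^ 2 * n ^ S := by
          have := card_not_injective_mul_le (I := I) (V := V)
          rw [hIcard] at this
          exact Nat.add_le_add_left this _
      _ = _ := by ring
  have hn' : (0 : ℝ) < n := by exact_mod_cast hn0
  calc _ ≤ _ := pow_le_pow_left₀ (by positivity) (by rw [pow_succ]; gcongr) _
    _ ≤ _ := h1
    _ ≤ (((s (Fin.last k) + S ^ 2) * n ^ S : ℕ) : ℝ) / (n ^ S * n) := by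
        gcongr
        exact h3.trans h4
    _ = _ := by
        push_cast
        field_simp

end Upper

/-! ### The order of magnitude of the Turán number -/

lemma card_le_turanNumber {W V : Type*} [Finite V] {K : Finset (Finset W)} {H : Finset (Finset V)}
    {d n : ℕ} (hK : ∀ w, ∃ e ∈ K, w ∈ e) (hV : Nat.card V ≤ n)
    (hH : (H : Set (Finset V)).Sized d) (hfree : ¬ ContainsCopy K H) :
    H.card ≤ turanNumber d n K := by
  classical
  have := Fintype.ofFinite V
  obtain ⟨j⟩ : Nonempty (V ↪ Fin n) := by
    apply Function.Embedding.nonempty_of_card_le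
    rwa [Fintype.card_fin, ← Nat.card_eq_fintype_card]
  let H' : Finset (Finset (Fin n)) := H.map (Finset.mapEmbedding j).toEmbedding
  have hH' : (H' : Set (Finset (Fin n))).Sized d := by
    intro e he
    obtain ⟨e', he', rfl⟩ := Finset.mem_map.1 (Finset.mem_coe.1 he)
    exact (Finset.card_map _).trans (hH he')
  have hfree' : ¬ ContainsCopy K H' := by
    rintro ⟨f, hf⟩
    apply hfree
    -- As `K` has no isolated vertices, a copy cannot use the added vertices.
    have h1 : ∀ w, ∃ v, j v = f w := by
      intro w
      obtain ⟨e, he, hw⟩ := hK w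
      obtain ⟨e', -, he'⟩ := Finset.mem_map.1 (hf e he)
      have h2 : f w ∈ e'.map j := by
        change e'.map j = e.map f at he'
        rw [he']
        exact Finset.mem_map_of_mem _ hw
      obtain ⟨v, -, hv⟩ := Finset.mem_map.1 h2
      exact ⟨v, hv⟩
    choose g hg using h1
    let g' : W ↪ V := ⟨g, fun w w' h => f.injective (by rw [← hg, ← hg, h])⟩
    refine ⟨g', fun e he => ?_⟩
    obtain ⟨e', he', h2⟩ := Finset.mem_map.1 (hf e he)
    have h3 : e.map g' = e' := by
      apply Finset.map_injective j
      change e'.map j = e.map f at h2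
      rw [h2, Finset.map_map]
      congr 1
      ext w
      exact congrArg Fin.val (hg w)
    rwa [h3]
  calc H.card = H'.card := (Finset.card_map _).symm
    _ ≤ _ := Finset.le_sup (f := Finset.card)
      (Finset.mem_filter.2 ⟨Finset.mem_univ H', hH', hfree'⟩)

lemma exists_mem_completePartite {d : ℕ} {s : Fin d → ℕ} (hs : ∀ i, 0 < s i)
    (w : Σ i, Fin (s i)) : ∃ e ∈ completePartite s, w ∈ e := by
  classical
  refine ⟨_, Finset.mem_image_of_mem _ (Finset.mem_univ
    (Function.update (fun i => ⟨0, hs i⟩) w.1 w.2)), ?_⟩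
  rw [mem_transversal, Function.update_self]

section Turan

variable {k : ℕ} {s : Fin (k + 1) → ℕ} {m : ℕ}

theorem turanNumber_isBigO (hs : ∀ i, 0 < s i) (hm : m = ∏ i : Fin k, s i.castSucc) :
    (fun n : ℕ => (turanNumber (k + 1) n (completePartite s) : ℝ)) =O[Filter.atTop]
      fun n : ℕ => (n : ℝ) ^ (((k + 1 : ℕ) : ℝ) - 1 / (m : ℝ)) := by
  classical
  have hm0 : m ≠ 0 := by
    rw [hm]
    exact (Finset.prod_pos fun i _ => hs _).ne'
  set C : ℝ := (s (Fin.last k) : ℝ) + (∑ i : Fin k, s i.castSucc : ℕ) ^ 2 with hC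
  have hC0 : 0 ≤ C := by positivity
  refine Asymptotics.IsBigO.of_bound (C ^ (1 / (m : ℝ))) ?_
  filter_upwards [Filter.eventually_gt_atTop 0] with n hn
  have hn' : (0 : ℝ) < n := by exact_mod_cast hn
  have : Nonempty (Fin n) := ⟨⟨0, hn⟩⟩
  rw [Real.norm_of_nonneg (Nat.cast_nonneg _), Real.norm_of_nonneg (by positivity)]
  refine le_trans (Nat.cast_le.2 (Finset.sup_le fun H hH => Nat.le_floor ?_))
    (Nat.floor_le (by positivity))
  obtain ⟨-, hH, hfree⟩ := Finset.mem_filter.1 hH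
  have h1 := density_pow_le_of_not_containsCopy hs hH hfree
  rw [← hm, ← hC, Nat.card_fin] at h1
  have h2 : (H.card : ℝ) / n ^ (k + 1) ≤ (C / n) ^ (1 / (m : ℝ)) := by
    rw [← Real.pow_rpow_inv_natCast (x := (H.card : ℝ) / n ^ (k + 1)) (by positivity) hm0,
      one_div]
    exact Real.rpow_le_rpow (by positivity) h1 (by positivity)
  rw [div_le_iff₀ (by positivity), Real.div_rpow hC0 hn'.le] at h2
  refine h2.trans_eq ?_
  rw [Real.rpow_sub hn', Real.rpow_natCast]
  ring

/-- The density of the norm hypergraphs, and the absence of copies of `K` in them. -/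
theorem normHypergraph_properties (hk : 1 ≤ k) (hs : ∀ i, 2 ≤ s i)
    (hm : m = ∏ i : Fin k, s i.castSucc) (hlast : (k * m)! + 1 ≤ s (Fin.last k))
    (p : ℕ) [Fact p.Prime] (E L : Type*) [Field E] [Field L] [Algebra (ZMod p) E]
    [Algebra (ZMod p) L] [Algebra E L] [IsScalarTower (ZMod p) E L]
    (hE : Nat.card E = p ^ m) (hL : Nat.card L = (p ^ m) ^ k) :
    (∃ α : Fin (k + 1) → L, GeneralPosition E α) ∧
    ∀ α : Fin (k + 1) → L, GeneralPosition E α →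
      (∃ F : Finset (Fin (k + 1) → E), GaloisSeparated α F ∧
        1 / (2 * (k : ℝ) ^ (k + 1)) * ((p : ℝ) ^ m) ^ (k + 1) ≤ (F.card : ℝ) ∧
        ∃ t : ZMod p, t ≠ 0 ∧
          1 / (2 * (k : ℝ) ^ (k + 1)) * (((p : ℝ) ^ m) ^ (k + 1) / (p : ℝ)) ≤
            ((normHypergraph p α F t).card : ℝ)) ∧
      (∀ F : Finset (Fin (k + 1) → E), GaloisSeparated α F →
        ∀ t : ZMod p, t ≠ 0 →
          (normHypergraph p α F t : Set (Finset (Σ _ : Fin (k + 1), E))).Sized (k + 1) ∧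
          ¬ ContainsCopy (completePartite s) (normHypergraph p α F t)) := by
  have hp : p.Prime := Fact.out
  have : Finite E := Nat.finite_of_card_ne_zero (by rw [hE]; exact (pow_pos hp.pos _).ne')
  have : Finite L :=
    Nat.finite_of_card_ne_zero (by rw [hL]; exact (pow_pos (pow_pos hp.pos _) _).ne')
  have hm2 : 2 ^ k ≤ m := by
    rw [hm]
    calc 2 ^ k = ∏ _i : Fin k, 2 := by simp
      _ ≤ _ := Finset.prod_le_prod' fun i _ => hs _
  have hEm : Module.finrank (ZMod p) E = m := by
    have h := Module.natCard_eq_pow_finrank (K := ZMod p) (V := E)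
    rw [hE, Nat.card_zmod] at h
    exact (Nat.pow_right_injective hp.two_le h).symm
  have hLk : Module.finrank E L = k := by
    have h := Module.natCard_eq_pow_finrank (K := E) (V := L)
    rw [hL, hE] at h
    have h2 : 2 ≤ p ^ m := by
      rw [← hE]
      exact Finite.one_lt_card
    exact (Nat.pow_right_injective h2 h).symm
  have hq : 2 * k ^ 2 ≤ Nat.card E := by
    rw [hE]
    exact (two_mul_sq_le_two_pow_two_pow k).trans ((Nat.pow_le_pow_right (by norm_num) hm2).trans
      (Nat.pow_le_pow_left hp.two_le _))
  refine ⟨exists_generalPosition hLk, fun α hα => ⟨?_, fun F hF t _ =>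
    ⟨normHypergraph_sized p α F t, ?_⟩⟩⟩
  · obtain ⟨F, hF, hF0, hFcard⟩ := exists_galoisSeparated hα hk hLk hq
    rw [hE, Nat.cast_pow] at hFcard
    obtain ⟨t, ht, htcard⟩ := exists_card_normHypergraph_ge p hF0
    refine ⟨F, hF, hFcard, t, ht, le_trans ?_ htcard⟩
    rw [← mul_div_assoc]
    gcongr
  · refine not_containsCopy_normHypergraph p hk s (fun i => by have := hs i; lia) (hEm.trans hm)
      ?_ hα hF t
    rw [hEm, hLk]
    exact (factorial_mul_pow_le_factorial hk m).trans_lt hlast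

/-- Lower bound for the Turán number from the norm hypergraph over a prime field. -/
lemma le_turanNumber_of_prime (hk : 1 ≤ k) (hs : ∀ i, 2 ≤ s i)
    (hm : m = ∏ i : Fin k, s i.castSucc) (hlast : (k * m)! + 1 ≤ s (Fin.last k))
    {p n : ℕ} (hp : p.Prime) (hn : (k + 1) * p ^ m ≤ n) :
    1 / (2 * (k : ℝ) ^ (k + 1)) * (((p : ℝ) ^ m) ^ (k + 1) / (p : ℝ)) ≤
      turanNumber (k + 1) n (completePartite s) := by
  have : Fact p.Prime := ⟨hp⟩
  have : NeZero k := ⟨by lia⟩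
  have hs0 : ∀ i, 0 < s i := fun i => by have := hs i; lia
  have hm0 : m ≠ 0 := by
    rw [hm]
    exact (Finset.prod_pos fun i _ => hs0 _).ne'
  have hE : Nat.card (GaloisField p m) = p ^ m := GaloisField.card p m hm0
  have : Finite (GaloisField p m) :=
    Nat.finite_of_card_ne_zero (by rw [hE]; exact (pow_pos hp.pos _).ne')
  obtain ⟨⟨α, hα⟩, h⟩ := normHypergraph_properties hk hs hm hlast p (GaloisField p m)
    (FiniteField.Extension (GaloisField p m) p k) hE
    (by rw [FiniteField.natCard_extension, hE])
  obtain ⟨⟨F, hF, -, t, ht, hcard⟩, hfree⟩ := h α hα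
  obtain ⟨h1, h2⟩ := hfree F hF t ht
  refine hcard.trans (Nat.cast_le.2 (card_le_turanNumber (exists_mem_completePartite hs0) ?_ h1 h2))
  rw [Nat.card_sigma]
  simpa [hE] using hn

theorem isBigO_turanNumber (hk : 1 ≤ k) (hs : ∀ i, 2 ≤ s i)
    (hm : m = ∏ i : Fin k, s i.castSucc) (hlast : (k * m)! + 1 ≤ s (Fin.last k)) :
    (fun n : ℕ => (n : ℝ) ^ (((k + 1 : ℕ) : ℝ) - 1 / (m : ℝ))) =O[Filter.atTop]
      fun n : ℕ => (turanNumber (k + 1) n (completePartite s) : ℝ) := by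
  have hm0 : 0 < m := by
    rw [hm]
    exact Finset.prod_pos fun i _ => by have := hs i.castSucc; lia
  have hmR : (0 : ℝ) < m := by exact_mod_cast hm0
  set β : ℝ := ((k + 1 : ℕ) : ℝ) - 1 / (m : ℝ) with hβ
  set c : ℝ := 1 / (2 * (k : ℝ) ^ (k + 1)) with hc
  have hc0 : 0 < c := by
    have : (0 : ℝ) < k := by exact_mod_cast hk
    positivity
  -- `M` is the exponent of `p` in `q^d / p`, and `M / m = β`.
  set M := m * (k + 1) - 1 with hM
  have hM1 : M + 1 = m * (k + 1) := Nat.sub_add_cancel (Nat.mul_pos hm0 k.succ_pos)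
  have hMβ : 1 / (m : ℝ) * M = β := by
    have h1 : (M : ℝ) + 1 = m * ((k + 1 : ℕ) : ℝ) := by exact_mod_cast hM1
    rw [hβ, eq_sub_of_add_eq h1]
    field_simp
  refine Asymptotics.IsBigO.of_bound (((k + 1 : ℕ) : ℝ) ^ β * 2 ^ M / c) ?_
  filter_upwards [Filter.eventually_ge_atTop ((k + 1) * 2 ^ m)] with n hn
  rw [Real.norm_of_nonneg (by positivity), Real.norm_of_nonneg (Nat.cast_nonneg _)]
  set y : ℝ := (n : ℝ) / ((k + 1 : ℕ) : ℝ) with hy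
  have hk1 : (0 : ℝ) < ((k + 1 : ℕ) : ℝ) := by positivity
  have hy0 : 0 ≤ y := by positivity
  set x : ℝ := y ^ (1 / (m : ℝ)) with hx
  have hxm : x ^ m = y := by
    rw [hx, one_div, Real.rpow_inv_natCast_pow hy0 hm0.ne']
  have hx0 : 0 ≤ x := by positivity
  have hx2 : 2 ≤ x := by
    rw [← pow_le_pow_iff_left₀ (by norm_num) hx0 hm0.ne', hxm, hy, le_div_iff₀ hk1, mul_comm]
    exact_mod_cast hn
  have hN0 : ⌊x / 2⌋₊ ≠ 0 := by
    have : 1 ≤ ⌊x / 2⌋₊ := Nat.le_floor (by push_cast; linarith)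
    lia
  -- Bertrand's postulate gives `x/2 ≤ p ≤ x`, where `x^m = n/(k + 1)`: the `(k + 1) p^m` vertices
  -- fit into `n`, and the loss is a factor `2^M`.
  obtain ⟨p, hp, hlt, hle⟩ := Nat.exists_prime_lt_and_le_two_mul _ hN0
  have hp0 : (0 : ℝ) < p := by exact_mod_cast hp.pos
  have hpx : (p : ℝ) ≤ x := by
    have h1 : (p : ℝ) ≤ 2 * ⌊x / 2⌋₊ := by exact_mod_cast hle
    have h2 := Nat.floor_le (show 0 ≤ x / 2 by positivity)
    linarith
  have hxp : x ≤ 2 * p := by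
    have h1 := (Nat.floor_lt (show 0 ≤ x / 2 by positivity)).1 hlt
    linarith
  have hpn : (k + 1) * p ^ m ≤ n := by
    have h1 : (p : ℝ) ^ m ≤ y := hxm ▸ pow_le_pow_left₀ hp0.le hpx m
    rw [hy, le_div_iff₀ hk1, mul_comm] at h1
    exact_mod_cast h1
  have hT := le_turanNumber_of_prime hk hs hm hlast hp hpn
  rw [← hc] at hT
  have hpM : ((p : ℝ) ^ m) ^ (k + 1) / p = (p : ℝ) ^ M := by
    rw [← pow_mul, ← hM1, pow_succ, mul_div_cancel_right₀ _ hp0.ne']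
  rw [hpM] at hT
  have hyβ : y ^ β = x ^ M := by
    rw [hx, ← Real.rpow_natCast, ← Real.rpow_mul hy0, hMβ]
  calc (n : ℝ) ^ β = ((k + 1 : ℕ) : ℝ) ^ β * x ^ M := by
        rw [← hyβ, ← Real.mul_rpow hk1.le hy0, hy, mul_div_cancel₀ _ hk1.ne']
    _ ≤ ((k + 1 : ℕ) : ℝ) ^ β * (2 * p) ^ M := by gcongr
    _ = ((k + 1 : ℕ) : ℝ) ^ β * 2 ^ M / c * (c * p ^ M) := by
        rw [mul_pow]
        field_simp
    _ ≤ _ := by gcongr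

end Turan

end NormHypergraph

/-- The uniformity is `d = k + 1`, and `m = s₁ ⋯ s_{d-1}`. -/
theorem mainTheorem2 (k : ℕ) (hk : 1 ≤ k) (s : Fin (k + 1) → ℕ) (hs : ∀ i, 2 ≤ s i)
    (m : ℕ) (hm : m = ∏ i : Fin k, s i.castSucc)
    (hlast : (k * m)! + 1 ≤ s (Fin.last k)) :
    -- the order of magnitude of the Turán number
    ((fun n : ℕ =>
        (NormHypergraph.turanNumber (k + 1) n (NormHypergraph.completePartite s) : ℝ))
      =Θ[Filter.atTop]
        fun n : ℕ => (n : ℝ) ^ (((k + 1 : ℕ) : ℝ) - 1 / (m : ℝ))) ∧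
    -- the norm hypergraphs over `𝔽_p ⊆ E = 𝔽_q ⊆ L = 𝔽_{q'}`, `q = p ^ m`, `q' = q ^ (d - 1)`
    ∃ c : ℝ, 0 < c ∧
      ∀ (p : ℕ) [Fact p.Prime] (E L : Type) [Field E] [Field L] [Algebra (ZMod p) E]
        [Algebra (ZMod p) L] [Algebra E L] [IsScalarTower (ZMod p) E L],
        Nat.card E = p ^ m → Nat.card L = (p ^ m) ^ k →
        (∃ α : Fin (k + 1) → L, NormHypergraph.GeneralPosition E α) ∧
        ∀ α : Fin (k + 1) → L, NormHypergraph.GeneralPosition E α →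
          -- there are a dense separated `F` and a `t` for which `H_t` has many edges
          (∃ F : Finset (Fin (k + 1) → E), NormHypergraph.GaloisSeparated α F ∧
            c * ((p : ℝ) ^ m) ^ (k + 1) ≤ (F.card : ℝ) ∧
            ∃ t : ZMod p, t ≠ 0 ∧
              c * (((p : ℝ) ^ m) ^ (k + 1) / (p : ℝ)) ≤
                ((NormHypergraph.normHypergraph p α F t).card : ℝ)) ∧
          -- every `H_t` is a `d`-uniform hypergraph without a copy of `K_{s₁, …, s_d}`
          (∀ F : Finset (Fin (k + 1) → E), NormHypergraph.GaloisSeparated α F →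
            ∀ t : ZMod p, t ≠ 0 →
              (NormHypergraph.normHypergraph p α F t :
                Set (Finset (Σ _ : Fin (k + 1), E))).Sized (k + 1) ∧
              ¬ NormHypergraph.ContainsCopy (NormHypergraph.completePartite s)
                (NormHypergraph.normHypergraph p α F t)) := by
  have hs0 : ∀ i, 0 < s i := fun i => two_pos.trans_le (hs i)
  have hk0 : (0 : ℝ) < k := by exact_mod_cast hk
  refine ⟨⟨NormHypergraph.turanNumber_isBigO hs0 hm,
    NormHypergraph.isBigO_turanNumber hk hs hm hlast⟩, 1 / (2 * (k : ℝ) ^ (k + 1)), by positivity,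
    fun p _ E L _ _ _ _ _ _ hE hL =>
      NormHypergraph.normHypergraph_properties hk hs hm hlast p E L hE hL⟩
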